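/- Let $K$ be a field and let $P$ be a nontrivial place on $K$ (places are identified if they have the same valuation ring) with valuation ring $\mathcal{O}_P\neq K$, associated valuation $v$, value group $vK$ and residue field $KP$, and put $p:=\max(1,\operatorname{char} KP)$. Let $K^{\rm sep}$ be a separable closure of $K$ and extend $P$ to a place $P^{\rm sep}$ of $K^{\rm sep}$ with valuation ring $\mathcal{O}^{\rm sep}$ and maximal ideal $\mathcal{M}^{\rm sep}$. Let $G_r$ be the ramification group of $P^{\rm sep}$, that is, the group of all $\sigma\in\operatorname{Gal}(K^{\rm sep}|K)$ such that $\sigma(\mathcal{O}^{\rm sep})=\mathcal{O}^{\rm sep}$, $\sigma(a)-a\in\mathcal{M}^{\rm sep}$ for all $a\in\mathcal{O}^{\rm sep}$, and $\frac{\sigma(a)}{a}-1\in\mathcal{M}^{\rm sep}$ for all $a\in K^{\rm sep}\setminus\{0\}$; its fixed field $K^r$ in $K^{\rm sep}$ is the absolute ramification field of $(K,P)$ (up to conjugation it does not depend on the choice of $P^{\rm sep}$). Call $(K,P)$ separably tame if it is henselian (i.e. $\mathcal{O}_P$ satisfies Hensel's Lemma) and $K^r=K^{\rm sep}$. An extension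 $(L,P')$ of $(K,P)$, i.e. an extension field $L$ of $K$ with a place $P'$ extending $P$, is called immediate if the canonical embeddings of value groups $vK\to v'L$, where $v'$ is the valuation associated to $P'$, and of residue fields $KP\to LP'$ are onto. Call $(K,P)$ separable-algebraically maximal if it admits no immediate extension $(L,P')$ with $L|K$ separable-algebraic and $L\neq K$. Then $(K,P)$ is separably tame if and only if it is separable-algebraically maximal, $vK$ is $p$-divisible and $KP$ is perfect. -/

import Mathlib

universe u

/-! Places of a field are considered up to equivalence, i.e. a place `P` of `K` is given by its
valuation ring `A = 𝒪_P`, a `ValuationSubring K`.  The residue field `KP` is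
`IsLocalRing.ResidueField A`, the (multiplicatively written) value group `vK` is the group of
non-zero elements `A.ValueGroupˣ`, and `A.valuation` is the associated valuation.  The place is
trivial iff `A = ⊤`. -/

namespace ValuedPlace

/-- Every place of `K` extends to every extension field of `K`. -/
theorem exists_extension {K L : Type*} [Field K] [Field L] [Algebra K L]
    (A : ValuationSubring K) :
    ∃ B : ValuationSubring L, B.comap (algebraMap K L) = A := by
  obtain ⟨B, hB⟩ := LocalSubring.exists_le_valuationSubring
    (A.toLocalSubring.map (algebraMap K L))
  obtain ⟨hle, hloc⟩ := hB
  have hmem : ∀ x ∈ A, algebraMap K L x ∈ B := fun x hx => hle ⟨x, hx, rfl⟩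
  refine ⟨B, ?_⟩
  ext x
  rw [ValuationSubring.mem_comap]
  refine ⟨fun hx => ?_, hmem x⟩
  rcases A.mem_or_inv_mem x with h | h
  · exact h
  · by_cases hx0 : x = 0
    · rw [hx0]; exact A.zero_mem
    have hu : IsUnit (Subring.inclusion hle
        ⟨algebraMap K L x⁻¹, ⟨x⁻¹, h, rfl⟩⟩) := by
      refine IsUnit.of_mul_eq_one ⟨algebraMap K L x, hx⟩ ?_
      apply Subtype.ext
      change algebraMap K L x⁻¹ * algebraMap K L x = 1
      rw [← map_mul, inv_mul_cancel₀ hx0, map_one]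
    obtain ⟨⟨z, y, hy, hyz⟩, hyy⟩ := (hloc.1 _ hu).exists_right_inv
    have h2 : algebraMap K L x⁻¹ * algebraMap K L y = 1 := by
      have h6 : algebraMap K L x⁻¹ * z = 1 := congrArg Subtype.val hyy
      rwa [← hyz] at h6
    rw [← map_mul] at h2
    have h3 : x⁻¹ * y = 1 := (algebraMap K L).injective (by rw [h2, map_one])
    have h4 : y = x := by
      field_simp at h3
      exact h3
    exact h4 ▸ hy

/-- For a place `B` of an extension field `L` of `K`, the ramification group `G_r`: all elements
`σ` of the inertia group `G_i` (itself contained in the decomposition group) such that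
`σ a / a - 1` has residue `0` for all non-zero `a` in `L`. -/
def ramificationGroup (K : Type*) {L : Type*} [Field K] [Field L] [Algebra K L]
    (B : ValuationSubring L) : Subgroup (L ≃ₐ[K] L) where
  carrier := {σ | σ ∈ (B.inertiaSubgroup K).map (B.decompositionSubgroup K).subtype ∧
    ∀ a : L, a ≠ 0 → B.valuation (σ a / a - 1) < 1}
  one_mem' := ⟨one_mem _, fun a ha => by simp [ha]⟩
  mul_mem' := by
    rintro σ τ ⟨hσ, hσ'⟩ ⟨hτ, hτ'⟩
    refine ⟨mul_mem hσ hτ, fun a ha => ?_⟩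
    have hta : τ a ≠ 0 := by simpa using ha
    have h1 := hσ' (τ a) hta
    have h2 := hτ' a ha
    have h3 : (σ * τ) a / a - 1
        = (σ (τ a) / τ a - 1) * (τ a / a - 1) + (σ (τ a) / τ a - 1) + (τ a / a - 1) := by
      rw [AlgEquiv.mul_apply]
      field_simp
      ring
    rw [h3]
    refine B.valuation.map_add_lt (B.valuation.map_add_lt ?_ h1) h2
    rw [map_mul]
    exact mul_lt_one_of_nonneg_of_lt_one_left zero_le h1 h2.le
  inv_mem' := by
    rintro σ ⟨hσ, hσ'⟩
    refine ⟨inv_mem hσ, fun a ha => ?_⟩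
    set b := σ⁻¹ a with hb
    have hsb : σ b = a := σ.apply_symm_apply a
    have hb0 : b ≠ 0 := by
      intro h
      rw [h, map_zero] at hsb
      exact ha hsb.symm
    have h1 := hσ' b hb0
    rw [hsb] at h1
    have h2 : B.valuation (a / b) = 1 := by
      have h5 : a / b = (a / b - 1) + 1 := by ring
      rw [h5]
      exact B.valuation.map_one_add_of_lt (x := a / b - 1) h1 ▸ by rw [add_comm]
    have h3 : b / a - 1 = -((a / b - 1) * (a / b)⁻¹) := by
      field_simp
      ring
    rw [h3, Valuation.map_neg, map_mul, map_inv₀, h2, inv_one, mul_one]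
    exact h1

/-- The absolute ramification field `K^r`, as a subfield of the separable closure `K^sep`, with
respect to a place `B` of `K^sep` : the fixed field of the ramification group. -/
noncomputable def absoluteRamificationField (K : Type*) [Field K]
    (B : ValuationSubring (SeparableClosure K)) : IntermediateField K (SeparableClosure K) :=
  IntermediateField.fixedField (ramificationGroup K B)

/-- `(K, P)` is henselian if its valuation ring satisfies Hensel's Lemma. -/
def IsHenselian {K : Type*} [Field K] (A : ValuationSubring K) : Prop :=
  HenselianLocalRing A

/-- `(K, P)` is separably tame if it is henselian and `K^sep = K^r`, where `K^r` is formed with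
respect to an extension `B` of the place to `K^sep`.  Such an extension exists
(`exists_extension`), and all of them are conjugate. -/
def IsSeparablyTame {K : Type*} [Field K] (A : ValuationSubring K) : Prop :=
  IsHenselian A ∧ ∀ B : ValuationSubring (SeparableClosure K),
    B.comap (algebraMap K (SeparableClosure K)) = A → absoluteRamificationField K B = ⊤

/-- `(L, B)` is an immediate extension of `(K, A)`: `B` lies over `A`, every value of `L` is the
value of an element of `K`, i.e. `vL = vK`, and every residue of `L` is the residue of an element
of `K`, i.e. `LP = KP`. -/
structure IsImmediate {K L : Type*} [Field K] [Field L] [Algebra K L]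
    (A : ValuationSubring K) (B : ValuationSubring L) : Prop where
  comap_eq : B.comap (algebraMap K L) = A
  value : ∀ y : L, ∃ x : K, B.valuation (algebraMap K L x) = B.valuation y
  residue : ∀ y : B, ∃ (x : K) (hx : algebraMap K L x ∈ B),
    IsLocalRing.residue B ⟨algebraMap K L x, hx⟩ = IsLocalRing.residue B y

/-- `(K, P)` is separable-algebraically maximal if it admits no proper immediate
separable-algebraic extension.  (An algebraic extension of `K` embeds into the algebraic closure
of `K`, so extension fields in the universe of `K` suffice.) -/
def IsSeparableAlgebraicallyMaximal {K : Type u} [Field K] (A : ValuationSubring K) : Prop :=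
  ∀ (L : Type u) [Field L] [Algebra K L] [Algebra.IsSeparable K L] (B : ValuationSubring L),
    IsImmediate A B → Function.Surjective (algebraMap K L)

/-- The value group `vK` is `n`-divisible (in multiplicative notation: every element of it is an
`n`-th power). -/
def IsValueGroupDivisible {K : Type*} [Field K] (A : ValuationSubring K) (n : ℕ) : Prop :=
  ∀ γ : A.ValueGroupˣ, ∃ δ : A.ValueGroupˣ, δ ^ n = γ

end ValuedPlace

namespace ValuedPlace

open Polynomial IntermediateField

/-! Since K^sep|K is Galois, K^r = K^sep means that the ramification group is trivial. If K is
henselian, the valuation v of K^sep is Galois invariant (`IsHenselian.valuation_algEquiv_apply`),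
and the ramification group is the group of all σ with v(σa − a) < v(a) for every a ≠ 0
(`wildGroup`).

Maximal implies tame. A separable a without a best approximation in K would yield a proper immediate
separable extension, by an argument in the style of Kaplansky
(`IsSeparableAlgebraicallyMaximal.hasBestApprox`). Best approximations give Hensel's Lemma through
one Newton step. Best approximations, separability of residues and values of order prime to p modulo
the base are collected in `IsTameBase`; they pass from F to F(t) when the distance of t to its other
conjugates is at least v(t) (`IsTameBase.adjoin`). For a outside F, subtracting a best approximation
exposes a new residue or a new value, and from it one builds such a t in F(a) outside F. An element
of the ramification group moves t by less than v(t), so it fixes t; induction on the degree of a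
shows that it fixes a (`IsTameBase.ringHom_apply_eq`).

Tame implies the rest. If the wild group is trivial, a finite subextension on whose residues the
Galois group acts trivially has degree prime to the residue characteristic
(`valuation_finrank_eq_one_of_wildGroup_eq_bot`). This rests on the absence of p-torsion in inertia
modulo wild inertia and on Dedekind's independence of characters, which provides an integral element
with trace of value 1. In an immediate subextension one may then divide traces by the degree, and an
element of trace 0 must vanish. If vK were not p-divisible or KP not perfect, an approximate p-th
root would generate an extension of degree p with trivial action on residues, a contradiction. -/

theorem comap_valuation_isEquiv {K L : Type*} [Field K] [Field L] (B : ValuationSubring L)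
    (f : K →+* L) :
    (B.comap f).valuation.IsEquiv (B.valuation.comap f) := by
  rw [Valuation.isEquiv_iff_valuationSubring, ValuationSubring.valuationSubring_valuation]
  ext x
  simp [Valuation.mem_valuationSubring_iff, ValuationSubring.valuation_le_one_iff]

/-! ### Valuation estimates, immediate extensions, approximation by separable elements -/

section General

variable {K L Γ : Type*} [Field K] [Field L] [Algebra K L] [LinearOrderedCommGroupWithZero Γ]

/-- `a` has a best approximation in `S`: the distances `v (a - d)`, `d ∈ S`, attain a minimum. -/
def HasBestApprox (v : Valuation L Γ) (S : Set L) (a : L) : Prop :=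
  ∃ c ∈ S, ∀ d ∈ S, v (a - c) ≤ v (a - d)

/-- If the minimal polynomial of `a` had zero derivative, the product rule would make the derivative
of each of its multiples vanish at `a`. -/
theorem isSeparable_of_simple_root {f : K[X]} {a : L} (h0 : aeval a f = 0)
    (h1 : aeval a (derivative f) ≠ 0) : IsSeparable K a := by
  have hf : f ≠ 0 := by
    rintro rfl
    simp at h1
  have halg : IsAlgebraic K a := ⟨f, hf, h0⟩
  have hint : IsIntegral K a := halg.isIntegral
  refine (separable_iff_derivative_ne_zero (minpoly.irreducible hint)).2 fun h => h1 ?_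
  obtain ⟨g, hg⟩ := minpoly.dvd K a h0
  rw [hg, derivative_mul, h]
  simp

theorem sub_lt_mul (v : Valuation L Γ) {x y x' y' : L} (h : v (x - y) < v y)
    (h' : v (x' - y') < v y') : v (x * x' - y * y') < v (y * y') := by
  have e : x * x' - y * y' = (x - y) * (x' - y') + ((x - y) * y' + y * (x' - y')) := by ring
  have hy : 0 < v y := lt_of_le_of_lt zero_le h
  have hy' : 0 < v y' := lt_of_le_of_lt zero_le h'
  rw [e]
  refine v.map_add_lt ?_ (v.map_add_lt ?_ ?_) <;> rw [map_mul, map_mul]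
  · exact mul_lt_mul'' h h' zero_le zero_le
  · exact mul_lt_mul_of_pos_right h hy'
  · exact mul_lt_mul_of_pos_left h' hy

theorem eq_of_sub_lt (v : Valuation L Γ) {x y : L} (h : v (x - y) < v y) : v x = v y :=
  v.map_eq_of_sub_lt h

/-- Each factor c − r differs from b − r by the negligible c − b, and relative closeness is
multiplicative by `sub_lt_mul`. -/
theorem eval_sub_lt_of_splits (v : Valuation L Γ) {g : L[X]} (hg : g.Splits) (hg0 : g ≠ 0)
    {b c : L} (h : ∀ r ∈ g.roots, v (c - b) < v (b - r)) :
    v (g.eval c - g.eval b) < v (g.eval b) := by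
  have key : ∀ s : Multiset L, (∀ r ∈ s, v (c - b) < v (b - r)) →
      v ((s.map (c - ·)).prod - (s.map (b - ·)).prod) < v ((s.map (b - ·)).prod) := by
    intro s
    induction s using Multiset.induction_on with
    | empty => intro _; simp
    | cons r s ih =>
      intro hs
      rw [Multiset.map_cons, Multiset.map_cons, Multiset.prod_cons, Multiset.prod_cons]
      refine sub_lt_mul v ?_ (ih fun r hr => hs r (Multiset.mem_cons_of_mem hr))
      rw [sub_sub_sub_cancel_right]
      exact hs r (Multiset.mem_cons_self r s)
  rw [hg.eval_eq_prod_roots, hg.eval_eq_prod_roots, ← mul_sub, map_mul, map_mul]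
  refine mul_lt_mul_of_pos_left (key _ h) ?_
  rw [v.pos_iff]
  simpa using hg0

/-- Every value of an algebraic extension is torsion modulo the values of the base field. -/
theorem exists_pow_valuation_eq (v : Valuation L Γ) {a : L} (ha : IsAlgebraic K a) (ha0 : a ≠ 0) :
    ∃ m : ℕ, 0 < m ∧ ∃ d : K, d ≠ 0 ∧ v a ^ m = v (algebraMap K L d) := by
  classical
  obtain ⟨f, hf0, hf⟩ := ha
  have hsum : ∑ i ∈ f.support, algebraMap K L (f.coeff i) * a ^ i = 0 := by
    rw [← hf, aeval_def, eval₂_eq_sum, Polynomial.sum]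
  obtain ⟨j, hj, hmax⟩ := f.support.exists_max_image
    (fun i => v (algebraMap K L (f.coeff i) * a ^ i)) (by simpa using hf0)
  have hne : ∀ i ∈ f.support, algebraMap K L (f.coeff i) ≠ 0 := fun i hi => by
    simpa using hi
  -- A vanishing sum cannot have a single term of maximal value, so a second index attains the
  -- maximum.
  have hex : ∃ i ∈ f.support, i ≠ j ∧ v (algebraMap K L (f.coeff i) * a ^ i)
      = v (algebraMap K L (f.coeff j) * a ^ j) := by
    by_contra! hcon
    have h1 := v.map_sum_eq_of_lt (f := fun i => algebraMap K L (f.coeff i) * a ^ i) hj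
      (fun i hi => by
        rw [Finset.mem_sdiff, Finset.mem_singleton] at hi
        exact lt_of_le_of_ne (hmax i hi.1) (hcon i hi.1 hi.2))
    rw [hsum, map_zero] at h1
    have := (v.zero_iff).1 h1.symm
    exact (mul_ne_zero (hne j hj) (pow_ne_zero _ ha0)) this
  have key : ∀ i j : ℕ, i < j → algebraMap K L (f.coeff i) ≠ 0 → algebraMap K L (f.coeff j) ≠ 0 →
      v (algebraMap K L (f.coeff i) * a ^ i) = v (algebraMap K L (f.coeff j) * a ^ j) →
      ∃ m : ℕ, 0 < m ∧ ∃ d : K, d ≠ 0 ∧ v a ^ m = v (algebraMap K L d) := by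
    intro i j hij hi hj h
    refine ⟨j - i, by omega, f.coeff i / f.coeff j, ?_, ?_⟩
    · rw [_root_.map_ne_zero] at hi hj
      exact div_ne_zero hi hj
    · have hj' : v (algebraMap K L (f.coeff j)) ≠ 0 := v.ne_zero_iff.2 hj
      have hva : v a ≠ 0 := v.ne_zero_iff.2 ha0
      rw [map_div₀, map_div₀, eq_div_iff hj']
      rw [map_mul, map_mul, map_pow, map_pow, show j = (j - i) + i by omega, pow_add,
        ← mul_assoc] at h
      have := mul_right_cancel₀ (pow_ne_zero i hva) h
      rw [show j - i + i = j by omega] at this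
      rw [this, mul_comm]
  obtain ⟨i, hi, hij, he⟩ := hex
  rcases lt_or_gt_of_ne hij with h | h
  · exact key i j h (hne i hi) (hne j hj) he
  · exact key j i h (hne j hj) (hne i hi) he.symm

theorem exists_valuation_le (v : Valuation L Γ) {a : L} (ha : IsAlgebraic K a) (ha0 : a ≠ 0) :
    ∃ d : K, d ≠ 0 ∧ v (algebraMap K L d) ≤ v a := by
  obtain ⟨m, hm, d, hd, h⟩ := exists_pow_valuation_eq (K := K) v ha ha0
  rcases le_total (v a) 1 with h1 | h1
  · exact ⟨d, hd, h ▸ pow_le_of_le_one zero_le h1 hm.ne'⟩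
  · exact ⟨1, one_ne_zero, by simpa using h1⟩

/-- Scale `y` to a unit by an element of K of the same value, then lift its residue. Together with
the converse below, this turns immediacy into one inequality that is easy to check and to transport.
-/
theorem IsImmediate.exists_sub_lt {A : ValuationSubring K} {B : ValuationSubring L}
    (h : IsImmediate A B) {y : L} (hy : y ≠ 0) :
    ∃ x : K, B.valuation (algebraMap K L x - y) < B.valuation y := by
  obtain ⟨c, hc⟩ := h.value y
  have hvy : B.valuation y ≠ 0 := B.valuation.ne_zero_iff.2 hy
  have hc0 : algebraMap K L c ≠ 0 := by
    rw [← B.valuation.ne_zero_iff, hc]; exact hvy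
  have hu : y / algebraMap K L c ∈ B := by
    rw [← B.valuation_le_one_iff, map_div₀, hc, div_self hvy]
  obtain ⟨x, hx, hxy⟩ := h.residue ⟨_, hu⟩
  refine ⟨x * c, ?_⟩
  rw [← sub_eq_zero, ← map_sub, IsLocalRing.residue_eq_zero_iff,
    ValuationSubring.valuation_lt_one_iff] at hxy
  have e : algebraMap K L (x * c) - y
      = (algebraMap K L x - y / algebraMap K L c) * algebraMap K L c := by
    rw [map_mul]; field_simp
  rw [e, map_mul, hc]
  exact mul_lt_of_lt_one_left (by rwa [B.valuation.pos_iff]) hxy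

theorem isImmediate_of_exists_sub_lt {A : ValuationSubring K} {B : ValuationSubring L}
    (hAB : B.comap (algebraMap K L) = A)
    (h : ∀ y : L, y ≠ 0 → ∃ x : K, B.valuation (algebraMap K L x - y) < B.valuation y) :
    IsImmediate A B := by
  refine ⟨hAB, fun y => ?_, fun y => ?_⟩
  · rcases eq_or_ne y 0 with rfl | hy
    · exact ⟨0, by simp⟩
    · obtain ⟨x, hx⟩ := h y hy
      exact ⟨x, eq_of_sub_lt _ hx⟩
  · rcases eq_or_ne y 0 with rfl | hy
    · refine ⟨0, by simp [B.zero_mem], ?_⟩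
      congr 1
      ext
      simp
    · obtain ⟨x, hx⟩ := h y (by simpa using hy)
      have hy1 := B.valuation_le_one y
      have hxm : algebraMap K L x ∈ B := by
        rw [← B.valuation_le_one_iff, eq_of_sub_lt _ hx]; exact hy1
      refine ⟨x, hxm, ?_⟩
      rw [← sub_eq_zero, ← map_sub, IsLocalRing.residue_eq_zero_iff,
        ValuationSubring.valuation_lt_one_iff]
      exact lt_of_lt_of_le hx hy1

/-- By continuity of roots, an algebraic element can be approximated by separable elements of at
most the same degree. -/
theorem exists_isSeparable_close [IsAlgClosed L] (v : Valuation L Γ) {r : L}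
    (hr : IsAlgebraic K r) {ε : K} (hε : ε ≠ 0) :
    ∃ r' : L, IsSeparable K r' ∧ (minpoly K r').natDegree ≤ (minpoly K r).natDegree ∧
      v (r - r') ≤ v (algebraMap K L ε) := by
  by_cases hsep : IsSeparable K r
  · exact ⟨r, hsep, le_rfl, by simp⟩
  have hint := hr.isIntegral
  set h := minpoly K r with hh
  have hder : derivative h = 0 := by
    by_contra hne
    exact hsep ((separable_iff_derivative_ne_zero (minpoly.irreducible hint)).2 hne)
  have hmon : h.Monic := minpoly.monic hint
  have hn : 1 < h.natDegree := by
    by_contra hle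
    have h1 : h.natDegree = 1 := le_antisymm (not_lt.1 hle) (minpoly.natDegree_pos hint)
    have h2 := congrArg (fun q => coeff q 0) hder
    simp only [coeff_derivative, coeff_zero] at h2
    have h3 : h.coeff 1 = 1 := by rw [← h1]; exact hmon
    simp [h3] at h2
  -- For f = h + δX one has f(r) = δr, which is also the product of the differences of r to the n
  -- roots of f, where n = deg h. If its value is at most v(ε)^n, some root is within v(ε) of r.
  obtain ⟨δ, hδ0, hδ⟩ : ∃ δ : K, δ ≠ 0 ∧
      v (algebraMap K L δ * r) ≤ v (algebraMap K L ε) ^ h.natDegree := by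
    rcases eq_or_ne r 0 with rfl | hr0
    · exact ⟨1, one_ne_zero, by simp⟩
    · obtain ⟨d, hd0, hd⟩ := exists_valuation_le (K := K) v
        (a := algebraMap K L ε ^ h.natDegree / r)
        (by rw [div_eq_mul_inv]; exact ((isAlgebraic_algebraMap ε).pow _).mul hr.inv)
        (div_ne_zero (pow_ne_zero _ (by simpa using hε)) hr0)
      refine ⟨d, hd0, ?_⟩
      have hvr : v r ≠ 0 := v.ne_zero_iff.2 hr0
      rw [map_div₀, map_pow, le_div_iff₀ (zero_lt_iff.2 hvr)] at hd
      rwa [map_mul]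
  -- Inseparability gives h' = 0, so f' is the nonzero constant δ and every root of f is separable.
  set f : K[X] := h + C δ * X with hf
  have hdeg : degree (C δ * X) < degree h := by
    refine lt_of_le_of_lt (degree_C_mul_X_le δ) ?_
    rw [degree_eq_natDegree hmon.ne_zero]
    exact_mod_cast hn
  have hfm : f.Monic := hmon.add_of_left hdeg
  have hfd : f.natDegree = h.natDegree := by
    rw [hf, natDegree_add_eq_left_of_degree_lt hdeg]
  have hf' : derivative f = C δ := by
    rw [hf, derivative_add, hder, zero_add, derivative_C_mul, derivative_X, mul_one]
  have heval : aeval r f = algebraMap K L δ * r := by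
    rw [hf, map_add, hh, minpoly.aeval]
    simp
  have hspl := IsAlgClosed.splits (f.map (algebraMap K L))
  have hprod : v (aeval r f) = ((f.aroots L).map fun s => v (r - s)).prod := by
    rw [← eval_map_algebraMap, hspl.eval_eq_prod_roots_of_monic (hfm.map _), map_multiset_prod,
      Multiset.map_map]
    rfl
  have hcard : (f.aroots L).card = h.natDegree := by
    rw [← hfd, ← natDegree_map (algebraMap K L)]
    exact hspl.natDegree_eq_card_roots.symm
  obtain ⟨s, hs, hrs⟩ : ∃ s ∈ f.aroots L, v (r - s) ≤ v (algebraMap K L ε) := by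
    by_contra! hcon
    have hlt : ∀ t : Multiset L, (∀ s ∈ t, v (algebraMap K L ε) < v (r - s)) → t ≠ 0 →
        v (algebraMap K L ε) ^ t.card < (t.map fun s => v (r - s)).prod := by
      intro t
      induction t using Multiset.induction_on with
      | empty => intro _ h; exact absurd rfl h
      | cons s t ih =>
        intro ht _
        rw [Multiset.card_cons, Multiset.map_cons, Multiset.prod_cons, pow_succ']
        have h1 := ht s (Multiset.mem_cons_self s t)
        rcases eq_or_ne t 0 with rfl | ht0
        · simpa using h1
        · exact mul_lt_mul'' h1 (ih (fun s hs => ht s (Multiset.mem_cons_of_mem hs)) ht0)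
            zero_le zero_le
    have h1 := hlt _ hcon (by rw [← Multiset.card_pos, hcard]; omega)
    rw [← hprod, heval, hcard] at h1
    exact absurd hδ (not_le.2 h1)
  have hs0 : aeval s f = 0 := ((mem_aroots).1 hs).2
  refine ⟨s, isSeparable_of_simple_root hs0 (by rw [hf']; simpa using hδ0), ?_, hrs⟩
  rw [← hfd]
  exact natDegree_le_of_dvd (minpoly.dvd K s hs0) hfm.ne_zero

end General

/-! ### Separable-algebraically maximal fields have best approximations -/

theorem exists_eq_aeval_of_mem_adjoin {K L : Type*} [Field K] [Field L] [Algebra K L] {b y : L}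
    (hb : IsIntegral K b) (hy : y ∈ K⟮b⟯) :
    ∃ g : K[X], g.natDegree < (minpoly K b).natDegree ∧ y = aeval b g := by
  obtain ⟨g, hg, hg'⟩ := (adjoin.powerBasis hb).exists_eq_aeval ⟨y, hy⟩
  refine ⟨g, by simpa using hg, ?_⟩
  have := congrArg (algebraMap K⟮b⟯ L) hg'
  rw [adjoin.powerBasis_gen] at this
  rw [← aeval_algebraMap_apply, AdjoinSimple.algebraMap_gen] at this
  exact this

/-- Without a best approximation, the elements of K approaching `a` have a limit b of minimal degree
outside K. Polynomials of smaller degree have no root among the limits, so their values at b are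
approximated by their values at points of K; hence K(b) is immediate over K. -/
theorem IsSeparableAlgebraicallyMaximal.hasBestApprox {K : Type u} [Field K]
    {A : ValuationSubring K} (hA : IsSeparableAlgebraicallyMaximal A)
    {B : ValuationSubring (AlgebraicClosure K)}
    (hB : B.comap (algebraMap K (AlgebraicClosure K)) = A) {a : AlgebraicClosure K}
    (ha : IsSeparable K a) :
    HasBestApprox B.valuation (Set.range (algebraMap K (AlgebraicClosure K))) a := by
  classical
  by_contra hno
  set ι := algebraMap K (AlgebraicClosure K)
  set v := B.valuation
  -- The limits: the intersection of all balls with centre c in K and radius v(a − c). An element of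
  -- K in S would be a best approximation of `a`.
  let S : Set (AlgebraicClosure K) := {b | ∀ c : K, v (b - ι c) ≤ v (a - ι c)}
  have hSK : ∀ k : K, ι k ∉ S := by
    intro k hk
    refine hno ⟨ι k, ⟨k, rfl⟩, ?_⟩
    rintro _ ⟨c, rfl⟩
    have := v.map_sub_le (le_refl (v (a - ι c))) (hk c)
    rwa [sub_sub_sub_cancel_right] at this
  have hex : ∃ n : ℕ, ∃ b ∈ S, IsSeparable K b ∧ (minpoly K b).natDegree = n :=
    ⟨_, a, fun c => le_rfl, ha, rfl⟩
  obtain ⟨b, hbS, hbsep, hbn⟩ := Nat.find_spec hex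
  have hmin : ∀ r ∈ S, IsSeparable K r → (minpoly K b).natDegree ≤ (minpoly K r).natDegree := by
    intro r hr hrs
    rw [hbn]
    exact Nat.find_min' hex ⟨r, hr, hrs, rfl⟩
  -- The degree of b is minimal among separable limits only, but roots of polynomials may be
  -- inseparable. If all balls have radius at least v(ε), a limit can be replaced by a separable one
  -- within v(ε), of no larger degree.
  have hmin' : ∀ r ∈ S, (minpoly K b).natDegree ≤ (minpoly K r).natDegree := by
    intro r hr
    by_cases hbd : ∃ ε : K, ε ≠ 0 ∧ ∀ c : K, v (ι ε) ≤ v (a - ι c)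
    · obtain ⟨ε, hε, hεc⟩ := hbd
      obtain ⟨r', hr', hdeg, hclose⟩ := exists_isSeparable_close (K := K) v
        (Algebra.IsAlgebraic.isAlgebraic r) hε
      refine (hmin r' (fun c => ?_) hr').trans hdeg
      have := v.map_sub_le (hr c) (hclose.trans (hεc c))
      rwa [sub_sub_sub_cancel_left] at this
    -- Radii without a positive lower bound leave `a` as the only limit.
    · push Not at hbd
      have hlim : ∀ r ∈ S, r = a := by
        intro r hr
        by_contra hne
        obtain ⟨ε, hε, hεr⟩ := exists_valuation_le (K := K) v
          (Algebra.IsAlgebraic.isAlgebraic (r - a)) (sub_ne_zero.2 hne)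
        obtain ⟨c, hc⟩ := hbd ε hε
        have := v.map_sub_le (hr c) (le_refl (v (a - ι c)))
        rw [sub_sub_sub_cancel_right] at this
        exact absurd (hεr.trans this) (not_le.2 hc)
      rw [hlim r hr, hlim b hbS]
  have happrox : ∀ g : K[X], g ≠ 0 → g.natDegree < (minpoly K b).natDegree →
      ∃ c : K, v (ι (g.eval c) - aeval b g) < v (aeval b g) := by
    intro g hg0 hg
    have hroot : ∀ r ∈ g.aroots (AlgebraicClosure K), ∃ c : K, v (a - ι c) < v (r - ι c) := by
      intro r hr
      have hrS : r ∉ S := fun hrS => by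
        have h1 := natDegree_le_of_dvd (minpoly.dvd K r ((mem_aroots).1 hr).2) hg0
        exact absurd ((hmin' r hrS).trans h1) (not_le.2 hg)
      simpa [S] using hrS
    choose! f hf using hroot
    -- Every root r of g is excluded by some centre f(r). The one closest to `a` excludes all roots
    -- at once.
    obtain ⟨c, hc⟩ : ∃ c : K, ∀ r ∈ g.aroots (AlgebraicClosure K),
        v (a - ι c) ≤ v (a - ι (f r)) := by
      rcases (g.aroots (AlgebraicClosure K)).toFinset.eq_empty_or_nonempty with he | hne
      · refine ⟨0, fun r hr => ?_⟩
        rw [← Multiset.mem_toFinset, he] at hr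
        simp at hr
      · obtain ⟨r, _, hr⟩ := Finset.exists_min_image _ (fun r => v (a - ι (f r))) hne
        exact ⟨f r, fun s hs => hr s (Multiset.mem_toFinset.2 hs)⟩
    refine ⟨c, ?_⟩
    have := eval_sub_lt_of_splits v (g := g.map ι) (IsAlgClosed.splits _)
      ((Polynomial.map_ne_zero_iff ι.injective).2 hg0) (b := b) (c := ι c) ?_
    · rwa [eval_map_apply, eval_map_algebraMap] at this
    · intro r hr
      have h1 := hf r hr
      have h2 : v (b - ι (f r)) < v (r - ι (f r)) := (hbS _).trans_lt h1
      have h3 : v (b - r) = v (r - ι (f r)) := by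
        rw [← sub_sub_sub_cancel_right b r (ι (f r)), v.map_sub_eq_of_lt_right h2]
      rw [h3, v.map_sub_swap]
      exact ((hbS c).trans (hc r hr)).trans_lt h1
  have : Algebra.IsSeparable K K⟮b⟯ := (isSeparable_adjoin_simple_iff_isSeparable K _).2 hbsep
  have himm : IsImmediate A (B.comap (algebraMap K⟮b⟯ (AlgebraicClosure K))) := by
    refine isImmediate_of_exists_sub_lt ?_ fun y hy => ?_
    · rw [ValuationSubring.comap_comap, ← IsScalarTower.algebraMap_eq, hB]
    · obtain ⟨g, hg, hyg⟩ := exists_eq_aeval_of_mem_adjoin hbsep.isIntegral y.2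
      obtain ⟨c, hc⟩ := happrox g (by rintro rfl; simp at hyg; exact hy hyg) hg
      refine ⟨g.eval c, ?_⟩
      rw [(comap_valuation_isEquiv B _).lt_iff_lt]
      rw [← hyg] at hc
      exact hc
  obtain ⟨k, hk⟩ := hA K⟮b⟯ _ himm ⟨b, mem_adjoin_simple_self K b⟩
  refine hSK k ?_
  have : ι k = b := congrArg (algebraMap K⟮b⟯ (AlgebraicClosure K)) hk
  rwa [this]

/-! ### Hensel's Lemma from best approximations -/

section Hensel

variable {K L Γ : Type*} [Field K] [Field L] [Algebra K L] [LinearOrderedCommGroupWithZero Γ]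

theorem coe_aeval_eq_eval_map (B : ValuationSubring L) (f : B[X]) (x : B) :
    ((f.eval x : B) : L) = (f.map (algebraMap B L)).eval (x : L) := by
  rw [← ValuationSubring.algebraMap_apply, ← ValuationSubring.algebraMap_apply, eval_map_apply]

/-- A monic polynomial with integral coefficients has a root close to a given approximate root. -/
theorem exists_root_close [IsAlgClosed L] (B : ValuationSubring L) {f : B[X]} (hf : f.Monic)
    {a : B} (ha : f.eval a ∈ IsLocalRing.maximalIdeal B) :
    ∃ r : B, f.IsRoot r ∧ r - a ∈ IsLocalRing.maximalIdeal B := by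
  set F := f.map (algebraMap B L)
  have hFm : F.Monic := hf.map _
  have hspl := IsAlgClosed.splits F
  obtain ⟨r, hr, hra⟩ : ∃ r ∈ F.roots, B.valuation ((a : L) - r) < 1 := by
    by_contra! hcon
    rw [ValuationSubring.valuation_lt_one_iff, coe_aeval_eq_eval_map,
      hspl.eval_eq_prod_roots_of_monic hFm, map_multiset_prod, Multiset.map_map] at ha
    refine absurd ha (not_lt.2 (Multiset.one_le_prod_of_one_le ?_))
    intro x hx
    obtain ⟨r, hr, rfl⟩ := Multiset.mem_map.1 hx
    exact hcon r hr
  have hrB : r ∈ B := by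
    have h1 : (a : L) - r ∈ B := (B.valuation_le_one_iff _).1 hra.le
    have := sub_mem a.2 h1
    rwa [sub_sub_cancel] at this
  refine ⟨⟨r, hrB⟩, ?_, ?_⟩
  · apply Subtype.ext
    rw [coe_aeval_eq_eval_map]
    exact (mem_roots'.1 hr).2
  · rw [ValuationSubring.valuation_lt_one_iff, ← Valuation.map_neg]
    simpa using hra

theorem isUnit_of_sub_mem_maximalIdeal {R : Type*} [CommRing R] [IsLocalRing R] {x y : R}
    (h : x - y ∈ IsLocalRing.maximalIdeal R) (hy : IsUnit y) : IsUnit x := by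
  by_contra hx
  have hx' : x ∈ IsLocalRing.maximalIdeal R := hx
  have := sub_mem hx' h
  rw [sub_sub_cancel] at this
  exact this hy

theorem isUnit_eval_of_sub_mem {R : Type*} [CommRing R] [IsLocalRing R] (g : R[X]) {x y : R}
    (h : x - y ∈ IsLocalRing.maximalIdeal R) (hy : IsUnit (g.eval y)) : IsUnit (g.eval x) := by
  refine isUnit_of_sub_mem_maximalIdeal ?_ hy
  exact Ideal.mem_of_dvd _ (sub_dvd_eval_sub x y g) h

end Hensel

/-- The algebraic closure contains a root α close to the approximate root. It is simple, hence
separable, and has a best approximation c in K. If α ≠ c, the Newton step from c would reach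
distance at most v(α − c)² < v(α − c). -/
theorem isHenselian_of_hasBestApprox {K : Type u} [Field K] {A : ValuationSubring K}
    {B : ValuationSubring (AlgebraicClosure K)}
    (hB : B.comap (algebraMap K (AlgebraicClosure K)) = A)
    (hbest : ∀ a : AlgebraicClosure K, IsSeparable K a →
      HasBestApprox B.valuation (Set.range (algebraMap K (AlgebraicClosure K))) a) :
    IsHenselian A := by
  set ι := algebraMap K (AlgebraicClosure K) with hι
  have hmem : ∀ x : K, ι x ∈ B ↔ x ∈ A := fun x => by rw [← hB]; rfl
  let φ : A →+* B := (ι.comp A.subtype).codRestrict B.toSubring fun x => (hmem x).2 x.2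
  have hφ : ∀ x : A, ((φ x : B) : AlgebraicClosure K) = ι x := fun x => rfl
  have hφm : ∀ x : A, φ x ∈ IsLocalRing.maximalIdeal B ↔ x ∈ IsLocalRing.maximalIdeal A := by
    intro x
    rw [ValuationSubring.valuation_lt_one_iff, ValuationSubring.valuation_lt_one_iff, hφ]
    subst hB
    have := (comap_valuation_isEquiv B ι).lt_one_iff_lt_one (x := (x : K))
    exact this.symm
  have hφu : ∀ x : A, IsUnit (φ x) ↔ IsUnit x := by
    intro x
    have := (hφm x).not
    rwa [IsLocalRing.mem_maximalIdeal, IsLocalRing.mem_maximalIdeal, mem_nonunits_iff,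
      mem_nonunits_iff, not_not, not_not] at this
  refine { is_henselian := fun f hf a₀ h0 h1 => ?_ }
  obtain ⟨α, hα, hαa⟩ := exists_root_close B (f := f.map φ) (hf.map φ) (a := φ a₀)
    (by rw [eval_map_apply, hφm]; exact h0)
  have hder : IsUnit ((f.map φ).derivative.eval (φ a₀)) := by
    rw [derivative_map, eval_map_apply, hφu]; exact h1
  have hαder : IsUnit ((f.map φ).derivative.eval α) := isUnit_eval_of_sub_mem _ hαa hder
  have hmap : (f.map φ).map (algebraMap B (AlgebraicClosure K)) =
      (f.map (algebraMap A K)).map ι := by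
    rw [Polynomial.map_map, Polynomial.map_map]; rfl
  have hαsep : IsSeparable K (α : AlgebraicClosure K) := by
    refine isSeparable_of_simple_root (f := f.map (algebraMap A K)) ?_ ?_
    · rw [← eval_map_algebraMap, ← hι, ← hmap, ← coe_aeval_eq_eval_map, hα.eq_zero]; rfl
    · rw [← eval_map_algebraMap, ← derivative_map, ← hι, ← hmap, derivative_map,
        ← coe_aeval_eq_eval_map]
      intro h
      exact hαder.ne_zero (Subtype.ext h)
  obtain ⟨_, ⟨c, rfl⟩, hc⟩ := hbest _ hαsep
  have hclt : B.valuation (α - ι c) < 1 := by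
    refine (hc _ ⟨a₀, rfl⟩).trans_lt ?_
    rw [ValuationSubring.valuation_lt_one_iff] at hαa
    exact hαa
  have hcA : c ∈ A := by
    have h1 : (α : AlgebraicClosure K) - ι c ∈ B := (B.valuation_le_one_iff _).1 hclt.le
    have := sub_mem α.2 h1
    rwa [sub_sub_cancel, hmem] at this
  set c' : A := ⟨c, hcA⟩
  have hαc : α - φ c' ∈ IsLocalRing.maximalIdeal B := by
    rw [ValuationSubring.valuation_lt_one_iff]
    exact hclt
  have hca : c' - a₀ ∈ IsLocalRing.maximalIdeal A := by
    rw [← hφm, map_sub]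
    have := sub_mem hαa hαc
    rwa [sub_sub_sub_cancel_left] at this
  refine ⟨c', ?_, hca⟩
  obtain ⟨u, hu⟩ : IsUnit (f.derivative.eval c') := isUnit_eval_of_sub_mem _ hca h1
  obtain ⟨w, hw⟩ := (f.map φ).binomExpansion (φ c') (α - φ c')
  rw [add_sub_cancel, hα.eq_zero, eval_map_apply, derivative_map, eval_map_apply, ← hu] at hw
  have hnewton : α - φ (c' - ↑u⁻¹ * f.eval c') = -(φ ↑u⁻¹ * w * (α - φ c') ^ 2) := by
    have hinv : φ ↑u⁻¹ * φ u = 1 := by rw [← map_mul]; simp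
    rw [map_sub, map_mul]
    linear_combination (-φ ↑u⁻¹) * hw - (α - φ c') * hinv
  have hle := hc _ ⟨((c' - ↑u⁻¹ * f.eval c' : A) : K), rfl⟩
  have h2 : (α : AlgebraicClosure K) - ι ((c' - ↑u⁻¹ * f.eval c' : A) : K)
      = -((φ ↑u⁻¹ * w : B) * ((α : AlgebraicClosure K) - ι c) ^ 2) :=
    congrArg (Subtype.val) hnewton
  rw [h2, Valuation.map_neg, map_mul, map_pow] at hle
  have hα0 : (α : AlgebraicClosure K) - ι c = 0 := by
    by_contra hne
    have hpos : 0 < B.valuation (α - ι c) := B.valuation.pos_iff.2 hne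
    refine absurd hle (not_le.2 ?_)
    calc _ ≤ 1 * B.valuation (α - ι c) ^ 2 := by
          gcongr; exact B.valuation_le_one _
      _ = B.valuation (α - ι c) * B.valuation (α - ι c) := by rw [one_mul, sq]
      _ < B.valuation (α - ι c) := mul_lt_of_lt_one_left hpos hclt
  have hαφ : α = φ c' := Subtype.ext (sub_eq_zero.1 hα0)
  rw [hαφ, IsRoot.def, eval_map_apply] at hα
  apply Subtype.ext
  have := congrArg Subtype.val hα
  rw [hφ] at this
  exact ι.injective (this.trans (map_zero ι).symm)

/-! ### Galois invariance of the extension of a henselian valuation -/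

section Invariance

variable {K L : Type*} [Field K] [Field L] [Algebra K L]

theorem valuation_eval_sub_le (B : ValuationSubring L) {g : L[X]} (hg : ∀ i, g.coeff i ∈ B)
    {x y : L} (hx : x ∈ B) (hy : y ∈ B) :
    B.valuation (g.eval x - g.eval y) ≤ B.valuation (x - y) := by
  have hl : g ∈ lifts (algebraMap B L) := by
    rw [lifts_iff_coeff_lifts]
    exact fun i => ⟨⟨_, hg i⟩, rfl⟩
  obtain ⟨G, rfl⟩ := (mem_lifts _).1 hl
  obtain ⟨w, hw⟩ := sub_dvd_eval_sub (⟨x, hx⟩ : B) ⟨y, hy⟩ G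
  have h2 := congrArg (Subtype.val) hw
  have h3 : (G.map (algebraMap B L)).eval x - (G.map (algebraMap B L)).eval y = (x - y) * w := by
    have e1 := coe_aeval_eq_eval_map B G ⟨x, hx⟩
    have e2 := coe_aeval_eq_eval_map B G ⟨y, hy⟩
    rw [← e1, ← e2]
    exact h2
  rw [h3, map_mul]
  exact mul_le_of_le_one_right zero_le (B.valuation_le_one w)

theorem valuation_eval_eq_one (B : ValuationSubring L) {g : L[X]} (hg : ∀ i, g.coeff i ∈ B)
    {x y : L} (hx : x ∈ B) (hy : y ∈ B) (hxy : B.valuation (x - y) < 1)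
    (h : B.valuation (g.eval y) = 1) : B.valuation (g.eval x) = 1 := by
  rw [← h]
  refine eq_of_sub_lt _ ?_
  rw [h]
  exact (valuation_eval_sub_le B hg hx hy).trans_lt hxy

/-- Hensel's Lemma for the valuation ring `B ∩ K`, in terms of the valuation of `B`. -/
theorem IsHenselian.exists_root {B : ValuationSubring L}
    (hA : IsHenselian (B.comap (algebraMap K L))) {F : K[X]} (hF : F.Monic)
    (hFB : ∀ i, algebraMap K L (F.coeff i) ∈ B) {k : K} (hk : algebraMap K L k ∈ B)
    (h0 : B.valuation (algebraMap K L (F.eval k)) < 1)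
    (h1 : B.valuation (algebraMap K L (F.derivative.eval k)) = 1) :
    ∃ y : K, F.eval y = 0 ∧ B.valuation (algebraMap K L (y - k)) < 1 := by
  set A := B.comap (algebraMap K L)
  have hequiv := comap_valuation_isEquiv B (algebraMap K L)
  have hl : F ∈ lifts (algebraMap A K) := by
    rw [lifts_iff_coeff_lifts]
    exact fun i => ⟨⟨_, hFB i⟩, rfl⟩
  obtain ⟨G, rfl, -, hG⟩ := lifts_and_natDegree_eq_and_monic hl hF
  obtain ⟨y, hy, hyk⟩ := hA.is_henselian G hG ⟨k, hk⟩
    (by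
      rw [ValuationSubring.valuation_lt_one_iff, hequiv.lt_one_iff_lt_one, coe_aeval_eq_eval_map]
      exact h0)
    (by
      rw [ValuationSubring.valuation_eq_one_iff, hequiv.eq_one_iff_eq_one, coe_aeval_eq_eval_map,
        ← derivative_map]
      exact h1)
  refine ⟨y, ?_, ?_⟩
  · rw [← coe_aeval_eq_eval_map, hy.eq_zero]; rfl
  · rw [ValuationSubring.valuation_lt_one_iff, hequiv.lt_one_iff_lt_one] at hyk
    exact hyk

/-- The minimal polynomial splits into linear factors over the conjugates, which are all integral.
-/
theorem coeff_minpoly_mem [Normal K L] (B : ValuationSubring L) {r : L}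
    (h : ∀ σ : L ≃ₐ[K] L, σ r ∈ B) (i : ℕ) : algebraMap K L ((minpoly K r).coeff i) ∈ B := by
  have hint : IsIntegral K r := Normal.isIntegral ‹_› r
  have hl := (Normal.splits ‹_› r).mem_lift_of_roots_mem_range
    ((minpoly.monic hint).map (algebraMap K L)) (algebraMap B L) fun a ha => by
      obtain ⟨σ, rfl⟩ := minpoly.exists_algEquiv_of_root' hint.isAlgebraic ((mem_aroots).1 ha).2
      exact ⟨⟨_, h σ⟩, rfl⟩
  rw [lifts_iff_coeff_lifts] at hl
  obtain ⟨b, hb⟩ := hl i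
  rw [coeff_map] at hb
  rw [← hb]
  exact b.2

/-- The elements of `Gal(L/K)` mapping `B` into itself form a subgroup when `L/K` is finite. -/
def stableSubgroup [FiniteDimensional K L] (B : ValuationSubring L) : Subgroup (L ≃ₐ[K] L) where
  carrier := {σ | ∀ x ∈ B, σ x ∈ B}
  one_mem' := fun x hx => hx
  mul_mem' := fun {σ τ} hσ hτ x hx => hσ _ (hτ x hx)
  inv_mem' := by
    intro σ hσ x hx
    have hpow : ∀ n : ℕ, ∀ x ∈ B, (σ ^ n) x ∈ B := by
      intro n
      induction n with
      | zero => exact fun x hx => hx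
      | succ n ih =>
        intro x hx
        rw [pow_succ']
        exact hσ _ (ih x hx)
    obtain ⟨n, hn⟩ := mem_powers_iff_mem_zpowers.2 (inv_mem (Subgroup.mem_zpowers σ))
    rw [← hn]
    exact hpow n x hx

theorem mem_stableSubgroup [FiniteDimensional K L] {B : ValuationSubring L} {σ : L ≃ₐ[K] L} :
    σ ∈ stableSubgroup B ↔ ∀ x ∈ B, σ x ∈ B := Iff.rfl

/-- A substitute for an approximation theorem: if `τ` moves some y out of `B`, cutting the equation
of y at a suitable degree separates `B` from its preimage under `τ`. -/
theorem exists_unit_of_not_mem [FiniteDimensional K L] {B : ValuationSubring L} {τ : L ≃ₐ[K] L}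
    (hτ : τ ∉ stableSubgroup B) :
    ∃ z : L, (∀ σ : L ≃ₐ[K] L, σ z ∈ B) ∧ B.valuation z = 1 ∧ B.valuation (τ z) < 1 := by
  rw [mem_stableSubgroup] at hτ
  push Not at hτ
  obtain ⟨y, hyB, hy⟩ := hτ
  set v := B.valuation
  set f := minpoly K y with hf
  have hint : IsIntegral K y := Algebra.IsIntegral.isIntegral y
  have hf0 : f ≠ 0 := minpoly.ne_zero hint
  -- The lexicographic order selects the last coefficient of maximal value. After division by it,
  -- later coefficients have value less than 1.
  obtain ⟨j, hj, hmax⟩ := f.support.exists_max_image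
    (fun i => toLex (v (algebraMap K L (f.coeff i)), i)) (by simpa using hf0)
  have hcj : f.coeff j ≠ 0 := by simpa using hj
  have hvj : v (algebraMap K L (f.coeff j)) ≠ 0 := v.ne_zero_iff.2 (by simpa using hcj)
  obtain ⟨a, ha⟩ : ∃ a : ℕ → L, ∀ i, a i = algebraMap K L (f.coeff i / f.coeff j) :=
    ⟨_, fun _ => rfl⟩
  have ha1 : ∀ i, v (a i) ≤ 1 := by
    intro i
    by_cases hi : i ∈ f.support
    · have := Prod.Lex.le_iff.1 (hmax i hi)
      rw [ha, map_div₀, map_div₀, div_le_one₀ (zero_lt_iff.2 hvj)]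
      rcases this with h | h
      · exact h.le
      · exact h.1.le
    · rw [notMem_support_iff] at hi
      simp [ha, hi]
  have ha2 : ∀ i, j < i → v (a i) < 1 := by
    intro i hij
    by_cases hi : i ∈ f.support
    · have := Prod.Lex.le_iff.1 (hmax i hi)
      rw [ha, map_div₀, map_div₀, div_lt_one₀ (zero_lt_iff.2 hvj)]
      rcases this with h | h
      · exact h
      · exact absurd h.2 (not_le.2 hij)
    · rw [notMem_support_iff] at hi
      simp [ha, hi]
  have haj : a j = 1 := by simp [ha, hcj]
  obtain ⟨m, hm⟩ : ∃ m, f.natDegree + 1 = j + (m + 1) :=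
    ⟨f.natDegree - j, by have := le_natDegree_of_mem_supp j hj; omega⟩
  have hfix : ∀ (σ : L ≃ₐ[K] L) i, σ (a i) = a i := fun σ i => by rw [ha, σ.commutes]
  have hsum : ∀ σ : L ≃ₐ[K] L, ∑ i ∈ Finset.range j, a i * σ y ^ i
      + σ y ^ j * ∑ i ∈ Finset.range (m + 1), a (j + i) * σ y ^ i = 0 := by
    intro σ
    have h0 : aeval (σ y) f = 0 := by rw [aeval_algHom_apply, hf, minpoly.aeval, map_zero]
    rw [aeval_eq_sum_range, hm, Finset.sum_range_add] at h0
    have h1 := congrArg (fun t => t / algebraMap K L (f.coeff j)) h0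
    simp only [zero_div, add_div, Finset.sum_div] at h1
    rw [← h1, Finset.mul_sum]
    congr 1
    · refine Finset.sum_congr rfl fun i _ => ?_
      rw [ha, map_div₀, Algebra.smul_def]
      ring
    · refine Finset.sum_congr rfl fun i _ => ?_
      rw [ha, map_div₀, Algebra.smul_def, pow_add]
      ring
  -- The upper part of the equation, divided by y^j. For integral y it is 1 plus terms of value less
  -- than 1. At a conjugate outside `B` it equals minus the lower part divided by (σy)^j, again of
  -- value less than 1.
  set z := ∑ i ∈ Finset.range (m + 1), a (j + i) * y ^ i with hz
  have hσz : ∀ σ : L ≃ₐ[K] L, σ z = ∑ i ∈ Finset.range (m + 1), a (j + i) * σ y ^ i := by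
    intro σ
    rw [hz, map_sum]
    exact Finset.sum_congr rfl fun i _ => by rw [map_mul, map_pow, hfix]
  have hlt : ∀ σ : L ≃ₐ[K] L, σ y ∉ B → v (σ z) < 1 := by
    intro σ hσ
    rw [← B.valuation_le_one_iff, not_le] at hσ
    have hσ0 : 0 < v (σ y) := zero_lt_one.trans hσ
    have h1 : v (σ y ^ j * σ z) < v (σ y ^ j) := by
      rw [hσz, eq_neg_of_add_eq_zero_right (hsum σ), v.map_neg]
      refine v.map_sum_lt' (by rw [map_pow]; exact pow_pos hσ0 _) fun i hi => ?_
      rw [map_mul, map_pow, map_pow]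
      calc v (a i) * v (σ y) ^ i ≤ v (σ y) ^ i := mul_le_of_le_one_left zero_le (ha1 i)
        _ < v (σ y) ^ j := pow_lt_pow_right₀ hσ (Finset.mem_range.1 hi)
    rw [map_mul] at h1
    exact (mul_lt_iff_lt_one_right (by rw [map_pow]; exact pow_pos hσ0 _)).1 h1
  refine ⟨z, fun σ => ?_, ?_, hlt τ hy⟩
  · by_cases hσ : σ y ∈ B
    · rw [hσz]
      refine sum_mem fun i _ => mul_mem ?_ (pow_mem hσ _)
      exact (B.valuation_le_one_iff _).1 (ha1 _)
    · exact (B.valuation_le_one_iff _).1 (hlt σ hσ).le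
  · rw [hz, Finset.sum_range_succ', add_zero, haj, pow_zero, mul_one, add_comm]
    refine v.map_one_add_of_lt (v.map_sum_lt' zero_lt_one fun i _ => ?_)
    rw [map_mul, map_pow]
    exact mul_lt_one_of_nonneg_of_lt_one_left zero_le (ha2 _ (by omega))
      (pow_le_one₀ zero_le ((B.valuation_le_one_iff _).2 hyB))

/-- The product r of the elements separating `B` from each `τ` is a unit of `B` and small at all `τ`
outside the stabilizer. Its equation over K turns this unit into an element congruent to 1. -/
theorem exists_close_to_one [FiniteDimensional K L] [Normal K L] (B : ValuationSubring L) :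
    ∃ x : L, (∀ σ : L ≃ₐ[K] L, σ x ∈ B) ∧ B.valuation (x - 1) < 1 ∧
      ∀ τ : L ≃ₐ[K] L, τ ∉ stableSubgroup B → B.valuation (τ x) < 1 := by
  classical
  set v := B.valuation with hv
  have h1 : ∀ τ : L ≃ₐ[K] L, ∃ z : L, (∀ σ : L ≃ₐ[K] L, σ z ∈ B) ∧ B.valuation z = 1 ∧
      (τ ∉ stableSubgroup B → B.valuation (τ z) < 1) := by
    intro τ
    by_cases hτ : τ ∈ stableSubgroup B
    · exact ⟨1, fun σ => by rw [map_one]; exact B.one_mem, map_one _, fun h => absurd hτ h⟩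
    · obtain ⟨z, hz, hz1, hzτ⟩ := exists_unit_of_not_mem hτ
      exact ⟨z, hz, hz1, fun _ => hzτ⟩
  choose z hz hz1 hzτ using h1
  set r := ∏ τ, z τ with hr
  have hrB : ∀ σ : L ≃ₐ[K] L, σ r ∈ B := fun σ => by
    rw [hr, map_prod]
    exact prod_mem fun τ _ => hz τ σ
  have hr1 : v r = 1 := by
    rw [hr, map_prod]
    exact Finset.prod_eq_one fun τ _ => hz1 τ
  have hrτ : ∀ τ : L ≃ₐ[K] L, τ ∉ stableSubgroup B → v (τ r) < 1 := by
    intro τ hτ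
    rw [hr, map_prod, map_prod, ← Finset.mul_prod_erase _ _ (Finset.mem_univ τ)]
    refine mul_lt_one_of_nonneg_of_lt_one_left zero_le (hzτ τ hτ) ?_
    exact Finset.prod_le_one' fun σ _ => (B.valuation_le_one_iff _).2 (hz σ τ)
  set f := minpoly K r
  have hint : IsIntegral K r := Algebra.IsIntegral.isIntegral r
  have hcB : ∀ i, algebraMap K L (f.coeff i) ∈ B := coeff_minpoly_mem B hrB
  have hex : ∃ j, v (algebraMap K L (f.coeff j)) = 1 :=
    ⟨f.natDegree, by rw [coeff_natDegree, (minpoly.monic hint).leadingCoeff, map_one, map_one]⟩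
  -- With j the first index of a unit coefficient, the terms below j are negligible. Hence c_j + rk
  -- is small and −rk/c_j is congruent to 1, while the factor r keeps it small at the other
  -- conjugates.
  set j := Nat.find hex
  have hvj : v (algebraMap K L (f.coeff j)) = 1 := Nat.find_spec hex
  have hlt : ∀ i < j, v (algebraMap K L (f.coeff i)) < 1 := fun i hi =>
    lt_of_le_of_ne ((B.valuation_le_one_iff _).2 (hcB i)) (Nat.find_min hex hi)
  set c : ℕ → L := fun i => algebraMap K L (f.coeff i) with hc
  have hc0 : c j ≠ 0 := by
    rw [← v.ne_zero_iff, hc, hvj]; exact one_ne_zero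
  have hr0 : r ≠ 0 := by
    rw [← v.ne_zero_iff, hr1]; exact one_ne_zero
  obtain ⟨m, hm⟩ : ∃ m, f.natDegree + 1 = j + (m + 1) := by
    refine ⟨f.natDegree - j, ?_⟩
    have : j ≤ f.natDegree := le_natDegree_of_ne_zero fun h => hc0 (by simp [hc, h])
    omega
  set k := ∑ i ∈ Finset.range m, c (j + (i + 1)) * r ^ i with hk
  have hsum : ∑ i ∈ Finset.range j, c i * r ^ i + r ^ j * (c j + r * k) = 0 := by
    have h0 : aeval r f = 0 := minpoly.aeval K r
    rw [aeval_eq_sum_range, hm, Finset.sum_range_add, Finset.sum_range_succ'] at h0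
    simp only [Algebra.smul_def] at h0
    rw [← h0, hk, Finset.mul_sum, mul_add, Finset.mul_sum, add_comm (r ^ j * c j)]
    congr 1
    congr 1
    · refine Finset.sum_congr rfl fun i _ => ?_
      rw [hc]
      ring
    · rw [hc, add_zero, mul_comm]
  have hfix : ∀ (σ : L ≃ₐ[K] L) i, σ (c i) = c i := fun σ i => σ.commutes _
  have hkB : ∀ σ : L ≃ₐ[K] L, σ k ∈ B := fun σ => by
    rw [hk, map_sum]
    refine sum_mem fun i _ => ?_
    rw [map_mul, map_pow, hfix]
    exact mul_mem (hcB _) (pow_mem (hrB σ) _)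
  have hx : ∀ σ : L ≃ₐ[K] L, v (σ (-(r * k / c j))) = v (σ r) * v (σ k) := fun σ => by
    rw [map_neg, v.map_neg, map_div₀, map_div₀, hfix, hc, hvj, div_one, map_mul, map_mul]
  refine ⟨-(r * k / c j), fun σ => ?_, ?_, fun τ hτ => ?_⟩
  · rw [← B.valuation_le_one_iff, ← hv, hx]
    exact mul_le_one₀ ((B.valuation_le_one_iff _).2 (hrB σ)) zero_le
      ((B.valuation_le_one_iff _).2 (hkB σ))
  · have e : -(r * k / c j) - 1 = (∑ i ∈ Finset.range j, c i * r ^ i) / (r ^ j * c j) := by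
      rw [eq_neg_of_add_eq_zero_left hsum]
      field_simp
      ring
    rw [e, map_div₀, map_mul, map_pow, hr1, hvj, one_pow, one_mul, div_one]
    refine v.map_sum_lt' zero_lt_one fun i hi => ?_
    rw [map_mul, map_pow, hr1, one_pow, mul_one]
    exact hlt i (Finset.mem_range.1 hi)
  · rw [hx]
    exact mul_lt_one_of_nonneg_of_lt_one_left zero_le (hrτ τ hτ)
      ((B.valuation_le_one_iff _).2 (hkB τ))

/-- The product s of the conjugates of x under the stabilizer D is fixed by D, congruent to 1, and
small after applying any `τ` outside D. So s is a simple root of its minimal polynomial modulo the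
maximal ideal, Hensel's Lemma gives a root in K near 1, and s itself lies in K. Then `τ` fixes s,
which has value 1, so D is everything. -/
theorem IsHenselian.stableSubgroup_eq_top [FiniteDimensional K L] [IsGalois K L]
    {B : ValuationSubring L} (hA : IsHenselian (B.comap (algebraMap K L))) :
    stableSubgroup (K := K) B = ⊤ := by
  classical
  set v := B.valuation
  set D : Subgroup (L ≃ₐ[K] L) := stableSubgroup B
  obtain ⟨x, hxB, hx1, hxτ⟩ := exists_close_to_one (K := K) B
  have hval : ∀ δ ∈ D, ∀ y : L, v y < 1 → v (δ y) < 1 := by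
    intro δ hδ y hy
    rcases eq_or_ne y 0 with rfl | hy0
    · simp
    by_contra hcon
    rw [not_lt, v.one_le_val_iff (by simpa using hy0), B.valuation_le_one_iff, ← map_inv₀] at hcon
    have := D.inv_mem hδ _ hcon
    have e : δ⁻¹ (δ y⁻¹) = y⁻¹ := δ.symm_apply_apply _
    rw [e, ← B.valuation_le_one_iff, ← v.one_le_val_iff hy0] at this
    exact absurd hy (not_lt.2 this)
  set s := ∏ δ : D, (δ : L ≃ₐ[K] L) x with hs
  have hsB : ∀ σ : L ≃ₐ[K] L, σ s ∈ B := fun σ => by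
    rw [hs, map_prod]
    exact prod_mem fun δ _ => hxB (σ * δ)
  have hs1 : v (s - 1) < 1 := by
    have key : ∀ t : Finset D, v (∏ δ ∈ t, (δ : L ≃ₐ[K] L) x - ∏ δ ∈ t, (1 : L))
        < v (∏ δ ∈ t, (1 : L)) := by
      intro t
      induction t using Finset.induction_on with
      | empty => simp
      | insert δ t hδ ih =>
        rw [Finset.prod_insert hδ, Finset.prod_insert hδ]
        refine sub_lt_mul v ?_ ih
        have := hval δ δ.2 _ hx1
        rwa [map_sub, map_one] at this
    simpa using key Finset.univ
  have hsD : ∀ δ ∈ D, δ s = s := by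
    intro δ hδ
    rw [hs, map_prod]
    exact Fintype.prod_equiv (Equiv.mulLeft (⟨δ, hδ⟩ : D)) _ _ fun _ => rfl
  have hsτ : ∀ τ : L ≃ₐ[K] L, τ ∉ D → v (τ s) < 1 := by
    intro τ hτ
    rw [hs, map_prod, map_prod, ← Finset.mul_prod_erase _ _ (Finset.mem_univ 1)]
    refine mul_lt_one_of_nonneg_of_lt_one_left zero_le (hxτ τ hτ) ?_
    exact Finset.prod_le_one' fun δ _ => (B.valuation_le_one_iff _).2 (hxB (τ * δ))
  have hvs : v s = 1 := by
    have := eq_of_sub_lt v (x := s) (y := 1) (by rwa [map_one])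
    rwa [map_one] at this
  have hint : IsIntegral K s := Algebra.IsIntegral.isIntegral s
  set F := minpoly K s with hF
  set FL := F.map (algebraMap K L) with hFL
  have hFm : F.Monic := minpoly.monic hint
  have hspl : FL.Splits := Normal.splits inferInstance s
  have hsroot : s ∈ FL.roots := (mem_aroots).2 ⟨hFm.ne_zero, minpoly.aeval K s⟩
  have hcB : ∀ i, algebraMap K L (F.coeff i) ∈ B := coeff_minpoly_mem B hsB
  have hroot : ∀ t ∈ FL.roots, ∃ σ : L ≃ₐ[K] L, σ s = t := fun t ht =>
    minpoly.exists_algEquiv_of_root' hint.isAlgebraic ((mem_aroots).1 ht).2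
  have hnodup : FL.roots.Nodup :=
    nodup_roots (Polynomial.Separable.map (Algebra.IsSeparable.isSeparable K s))
  have hder : v (FL.derivative.eval s) = 1 := by
    rw [hspl.eval_root_derivative (hFm.map _) hsroot, map_multiset_prod, Multiset.map_map]
    refine Multiset.prod_eq_one fun y hy => ?_
    obtain ⟨t, ht, rfl⟩ := Multiset.mem_map.1 hy
    rw [hnodup.mem_erase_iff] at ht
    obtain ⟨σ, rfl⟩ := hroot t ht.2
    have hσ : σ ∉ D := fun h => ht.1 (hsD σ h)
    simp only [Function.comp_apply]
    rw [v.map_sub_eq_of_lt_left (by rw [hvs]; exact hsτ σ hσ), hvs]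
  have hFLB : ∀ i, FL.coeff i ∈ B := fun i => by rw [coeff_map]; exact hcB i
  have hFL'B : ∀ i, FL.derivative.coeff i ∈ B := fun i => by
    rw [coeff_derivative]
    exact mul_mem (hFLB _) (add_mem (natCast_mem B i) (one_mem B))
  have hs1' : v (1 - s) < 1 := by rwa [v.map_sub_swap]
  obtain ⟨y, hy, hy1⟩ := hA.exists_root hFm hcB (k := 1) (by rw [map_one]; exact one_mem B)
    (by
      rw [← eval_map_apply, ← hFL, map_one]
      have := valuation_eval_sub_le B hFLB (one_mem B) (hsB 1)
      rw [show (1 : L ≃ₐ[K] L) s = s from rfl, ((mem_roots'.1 hsroot).2 : FL.eval s = 0),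
        sub_zero] at this
      exact this.trans_lt hs1')
    (by
      rw [← eval_map_apply, ← derivative_map, ← hFL, map_one]
      exact valuation_eval_eq_one B hFL'B (one_mem B) (hsB 1) hs1' hder)
  obtain ⟨σ, hσ⟩ := minpoly.exists_algEquiv_of_root' (K := K) hint.isAlgebraic
    (x := algebraMap K L y)
    (by rw [← hF, aeval_algebraMap_apply, coe_aeval_eq_eval, hy, map_zero])
  have hsK : s = algebraMap K L y := by
    apply σ.injective
    rw [hσ, σ.commutes]
  rw [eq_top_iff]
  intro τ _
  by_contra hτ
  have := hsτ τ hτ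
  rw [hsK, τ.commutes, ← hsK, hvs] at this
  exact lt_irrefl _ this

end Invariance

section Invariance

variable {K L : Type*} [Field K] [Field L] [Algebra K L]

/-- A henselian valuation extends uniquely to every Galois extension, so that its extension is
Galois invariant. -/
theorem IsHenselian.valuation_algEquiv_apply [IsGalois K L] {B : ValuationSubring L}
    (hA : IsHenselian (B.comap (algebraMap K L))) (σ : L ≃ₐ[K] L) (x : L) :
    B.valuation (σ x) = B.valuation x := by
  have hmem : ∀ x ∈ B, σ x ∈ B := by
    intro x hx
    let M := FiniteGaloisIntermediateField.adjoin K {x}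
    have hxM : x ∈ M.toIntermediateField :=
      FiniteGaloisIntermediateField.subset_adjoin K {x} (Set.mem_singleton x)
    have hM : IsHenselian ((B.comap (algebraMap M L)).comap (algebraMap K M)) := by
      rwa [ValuationSubring.comap_comap, ← IsScalarTower.algebraMap_eq]
    have hτ : AlgEquiv.restrictNormalHom M σ ∈ stableSubgroup (B.comap (algebraMap M L)) := by
      rw [hM.stableSubgroup_eq_top]
      exact Subgroup.mem_top _
    have := hτ ⟨x, hxM⟩ hx
    rw [ValuationSubring.mem_comap] at this
    rwa [show algebraMap M L (AlgEquiv.restrictNormalHom M σ ⟨x, hxM⟩) = σ x from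
      AlgEquiv.restrictNormal_commutes σ M ⟨x, hxM⟩] at this
  rcases eq_or_ne x 0 with rfl | hx
  · simp
  -- Stability only controls integrality. Applied to the unit x^m/d and to its inverse it gives
  -- equality of values, since `σ` fixes d.
  obtain ⟨m, hm, d, hd, h⟩ := exists_pow_valuation_eq (K := K) B.valuation
    (Algebra.IsAlgebraic.isAlgebraic x) hx
  have hd' : algebraMap K L d ≠ 0 := by simpa using hd
  have hvd : B.valuation (algebraMap K L d) ≠ 0 := B.valuation.ne_zero_iff.2 hd'
  have h1 : B.valuation (x ^ m / algebraMap K L d) = 1 := by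
    rw [map_div₀, map_pow, h, div_self hvd]
  have h2 := (B.valuation_le_one_iff _).2 (hmem _ ((B.valuation_le_one_iff _).1 h1.le))
  have h3 := (B.valuation_le_one_iff _).2
    (hmem _ ((B.valuation_le_one_iff _).1 (B.valuation.val_eq_one_iff.1 h1).le))
  rw [map_inv₀, ← B.valuation.one_le_val_iff
    ((map_ne_zero_iff σ σ.injective).2 (div_ne_zero (pow_ne_zero m hx) hd'))] at h3
  have h4 := le_antisymm h2 h3
  rw [map_div₀, map_pow, σ.commutes, map_div₀, map_pow, div_eq_one_iff_eq hvd, ← h] at h4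
  exact (pow_left_inj₀ zero_le zero_le hm.ne').1 h4

end Invariance

/-! ### Hensel's Lemma in separably closed fields and uniqueness of lifted roots -/

section Hensel

variable {L : Type*} [Field L]

/-- Hensel's Lemma in a separably closed field. -/
theorem exists_root_close_of_isSepClosed [IsSepClosed L] (B : ValuationSubring L) {f : L[X]}
    (hf : f.Monic) (hfB : ∀ i, f.coeff i ∈ B) {a : L} (ha : a ∈ B)
    (h0 : B.valuation (f.eval a) < 1) (h1 : B.valuation (f.derivative.eval a) = 1) :
    ∃ t : L, f.eval t = 0 ∧ B.valuation (t - a) < 1 := by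
  set j := algebraMap L (AlgebraicClosure L) with hj
  obtain ⟨B', hB'⟩ := exists_extension (L := AlgebraicClosure L) B
  have hequiv := comap_valuation_isEquiv B' j
  rw [hB'] at hequiv
  have hmem : ∀ x, j x ∈ B' ↔ x ∈ B := fun x => by rw [← hB']; rfl
  set F := f.map j with hF
  have hl : F ∈ lifts (algebraMap B' (AlgebraicClosure L)) := by
    rw [lifts_iff_coeff_lifts]
    exact fun i => ⟨⟨_, (hmem _).2 (hfB i)⟩, by rw [coeff_map]; rfl⟩
  obtain ⟨G, hG, -, hGm⟩ := lifts_and_natDegree_eq_and_monic hl (hf.map j)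
  obtain ⟨r, hr, hra⟩ := exists_root_close B' hGm (a := ⟨j a, (hmem a).2 ha⟩)
    (by
      rw [ValuationSubring.valuation_lt_one_iff, coe_aeval_eq_eval_map, hG, hF, eval_map_apply]
      exact hequiv.lt_one_iff_lt_one.1 h0)
  rw [ValuationSubring.valuation_lt_one_iff] at hra
  have hFr : F.eval (r : AlgebraicClosure L) = 0 := by
    rw [← hG, ← coe_aeval_eq_eval_map, hr.eq_zero]; rfl
  have hFB : ∀ i, F.derivative.coeff i ∈ B' := fun i => by
    rw [coeff_derivative, coeff_map]
    exact mul_mem ((hmem _).2 (hfB _)) (add_mem (natCast_mem B' i) (one_mem B'))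
  have hder : B'.valuation (F.derivative.eval (r : AlgebraicClosure L)) = 1 := by
    refine valuation_eval_eq_one B' hFB r.2 ((hmem a).2 ha) hra ?_
    rw [hF, derivative_map, eval_map_apply]
    exact hequiv.eq_one_iff_eq_one.1 h1
  -- Being a simple root, r is separable over L and therefore lies in L.
  have hsep : IsSeparable L (r : AlgebraicClosure L) := by
    refine isSeparable_of_simple_root (f := f) ?_ ?_
    · rw [← eval_map_algebraMap]; exact hFr
    · rw [← eval_map_algebraMap, ← derivative_map]
      intro h
      rw [← hj, ← hF] at h
      rw [h, map_zero] at hder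
      exact zero_ne_one hder
  have hdeg := IsSepClosed.degree_eq_one_of_irreducible L (minpoly.irreducible hsep.isIntegral) hsep
  obtain ⟨t, ht⟩ := minpoly.mem_range_of_degree_eq_one L _ hdeg
  refine ⟨t, ?_, ?_⟩
  · apply j.injective
    rw [← eval_map_apply, ht, map_zero]
    exact hFr
  · rw [hequiv.lt_one_iff_lt_one]
    change B'.valuation (j (t - a)) < 1
    rw [map_sub, ht]
    exact hra

/-- A simple root modulo the maximal ideal is not congruent to another root. -/
theorem eq_of_isRoot_of_sub_lt (B : ValuationSubring L) {f : L[X]} (hfB : ∀ i, f.coeff i ∈ B)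
    {s t : L} (ht : t ∈ B) (h1 : B.valuation (f.derivative.eval t) = 1)
    (ht0 : f.eval t = 0) (hs0 : f.eval s = 0) (hst : B.valuation (s - t) < 1) : s = t := by
  have hl : f ∈ lifts (algebraMap B L) := by
    rw [lifts_iff_coeff_lifts]
    exact fun i => ⟨⟨_, hfB i⟩, rfl⟩
  obtain ⟨G, rfl⟩ := (mem_lifts _).1 hl
  have hstB : s - t ∈ B := (B.valuation_le_one_iff _).1 hst.le
  -- If s ≠ t, dividing the Taylor expansion at t by s − t gives f'(t) = −w(s − t), which is not a
  -- unit.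
  obtain ⟨w, hw⟩ := G.binomExpansion ⟨t, ht⟩ ⟨s - t, hstB⟩
  have h2 := congrArg (algebraMap B L) hw
  rw [map_add, map_add, map_mul, map_mul, ← eval_map_apply, ← eval_map_apply, ← eval_map_apply,
    map_add, ← derivative_map, map_pow] at h2
  simp only [ValuationSubring.algebraMap_apply] at h2
  rw [add_sub_cancel, ht0, hs0, zero_add] at h2
  by_contra hne
  have h3 : (G.map (algebraMap B L)).derivative.eval t = -(w * (s - t)) := by
    have := sub_ne_zero.2 hne
    apply mul_right_cancel₀ this
    linear_combination -h2
  rw [h3, B.valuation.map_neg, map_mul] at h1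
  exact absurd h1 (mul_lt_one_of_nonneg_of_lt_one_right (B.valuation_le_one w) zero_le hst).ne

end Hensel

/-! ### Best approximations in a simple extension -/

section Adjoin

variable {F L Γ : Type*} [Field F] [Field L] [Algebra F L] [LinearOrderedCommGroupWithZero Γ]

/-- The Gauss norm of radius `ρ` is submultiplicative. -/
theorem valuation_coeff_prod_mul_pow_le (v : Valuation L Γ) (ρ : Γ) {ι : Type*} (s : Finset ι)
    (P : ι → L[X]) (h : ∀ k ∈ s, ∀ i, v ((P k).coeff i) * ρ ^ i ≤ 1) (i : ℕ) :
    v ((∏ k ∈ s, P k).coeff i) * ρ ^ i ≤ 1 := by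
  refine Finset.prod_induction P (fun Q => ∀ i, v (Q.coeff i) * ρ ^ i ≤ 1) ?_ ?_ h i
  · intro Q Q' hQ hQ' i
    rcases eq_or_ne ρ 0 with rfl | hρ
    · rcases i.eq_zero_or_pos with rfl | hi
      · rw [mul_coeff_zero, map_mul]
        have h1 := hQ 0
        have h2 := hQ' 0
        rw [pow_zero, mul_one] at h1 h2 ⊢
        exact mul_le_one₀ h1 zero_le h2
      · rw [zero_pow hi.ne', mul_zero]; exact zero_le
    have hρi : 0 < ρ ^ i := pow_pos (zero_lt_iff.2 hρ) i
    rw [← le_div_iff₀ hρi, coeff_mul]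
    refine v.map_sum_le fun kl hkl => ?_
    rw [le_div_iff₀ hρi, ← Finset.HasAntidiagonal.mem_antidiagonal.1 hkl, pow_add, map_mul,
      mul_mul_mul_comm]
    exact mul_le_one₀ (hQ _) zero_le (hQ' _)
  · intro i
    rw [coeff_one]
    split_ifs with hi
    · simp [hi]
    · simp

/-- Best approximations in `F` yield best approximations in `F(t)`, provided that the distance of
`t` to its conjugates is as large as possible. -/
theorem hasBestApprox_adjoin [IsGalois F L] (v : Valuation L Γ)
    (hv : ∀ (σ : L ≃ₐ[F] L) (x : L), v (σ x) = v x)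
    (hbest : ∀ a : L, HasBestApprox v (Set.range (algebraMap F L)) a) {t : L} (ht0 : t ≠ 0)
    (ht : ∀ σ : L ≃ₐ[F] L, σ t ≠ t → v t ≤ v (σ t - t)) (a : L) :
    HasBestApprox v (F⟮t⟯ : Set L) a := by
  classical
  set f := minpoly F t
  have hint : IsIntegral F t := Algebra.IsIntegral.isIntegral t
  set R := (f.aroots L).toFinset with hR
  have hcard : R.card = f.natDegree := by
    rw [hR, Multiset.toFinset_card_of_nodup
      (nodup_roots (Polynomial.Separable.map (Algebra.IsSeparable.isSeparable F t))),
      ← (Normal.splits inferInstance t).natDegree_eq_card_roots, natDegree_map]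
  have hs : ∀ τ ∈ R, ∃ σ : L ≃ₐ[F] L, σ t = τ := fun τ hτ =>
    minpoly.exists_algEquiv_of_root' hint.isAlgebraic
      ((mem_aroots).1 (Multiset.mem_toFinset.1 hτ)).2
  choose! s hs using hs
  have hρ : 0 < v t := v.pos_iff.2 ht0
  -- A factor (X − τ')/(τ − τ') of a Lagrange basis polynomial has Gauss norm at most 1 for the
  -- radius v(t), because v(τ') = v(t) ≤ v(τ − τ').
  have hcoeff : ∀ τ ∈ R, ∀ i, v ((Lagrange.basis R id τ).coeff i) * v t ^ i ≤ 1 := by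
    intro τ hτ
    refine valuation_coeff_prod_mul_pow_le v _ _ _ fun τ' hτ' i => ?_
    rw [Finset.mem_erase] at hτ'
    have hvτ' : v τ' = v t := by rw [← hs τ' hτ'.2, hv]
    have hdist : v t ≤ v (τ - τ') := by
      have h1 := ht ((s τ)⁻¹ * s τ') fun h => hτ'.1 (by
        have h2 := congrArg (s τ) h
        rw [AlgEquiv.mul_apply, hs τ hτ, hs τ' hτ'.2] at h2
        rw [← h2]
        exact ((s τ).apply_symm_apply τ').symm)
      rw [← hv (s τ) (_ - t), map_sub (s τ), AlgEquiv.mul_apply, hs τ hτ, hs τ' hτ'.2,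
        v.map_sub_swap] at h1
      rwa [show s τ ((s τ)⁻¹ τ') = τ' from (s τ).apply_symm_apply τ'] at h1
    have hpos : 0 < v (τ - τ') := hρ.trans_le hdist
    simp only [id, Lagrange.basisDivisor]
    rw [coeff_C_mul, map_mul, map_inv₀, mul_assoc, inv_mul_le_iff₀ hpos, mul_one]
    rcases i with _ | _ | i
    · rw [pow_zero, mul_one, coeff_sub, coeff_X_zero, coeff_C_zero, zero_sub, v.map_neg, hvτ']
      exact hdist
    · simpa using hdist
    · rw [coeff_sub, coeff_X_of_ne_one (by omega), coeff_C_of_ne_zero (by omega)]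
      simp
  -- The coefficients of the polynomial interpolating the conjugates of `a`. For g(t) in place of
  -- `a`, with g over F of degree below that of t, they are the coefficients of g; so approximating
  -- `a` in F(t) reduces to approximating each `b i` in F.
  set b : ℕ → L := fun i => ∑ τ ∈ R, s τ a * (Lagrange.basis R id τ).coeff i with hb
  have hc : ∀ i, ∃ c : F, ∀ d : F, v (b i - algebraMap F L c) ≤ v (b i - algebraMap F L d) := by
    intro i
    obtain ⟨_, ⟨c, rfl⟩, hc⟩ := hbest (b i)
    exact ⟨c, fun d => hc _ ⟨d, rfl⟩⟩
  choose c hc using hc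
  refine ⟨∑ i ∈ Finset.range f.natDegree, algebraMap F L (c i) * t ^ i, ?_, ?_⟩
  · exact sum_mem fun i _ => mul_mem (_root_.algebraMap_mem _ _)
      (pow_mem (mem_adjoin_simple_self F t) i)
  rintro d hd
  obtain ⟨g, hg, rfl⟩ := exists_eq_aeval_of_mem_adjoin hint hd
  have hgi : ∀ i, algebraMap F L (g.coeff i)
      = ∑ τ ∈ R, s τ (aeval t g) * (Lagrange.basis R id τ).coeff i := by
    intro i
    have h1 : g.map (algebraMap F L) = Lagrange.interpolate R id fun τ => s τ (aeval t g) := by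
      refine Lagrange.eq_interpolate_of_eval_eq _ Function.injective_id.injOn ?_ fun τ hτ => ?_
      · rw [hcard]
        refine degree_le_natDegree.trans_lt ?_
        rw [natDegree_map]
        exact_mod_cast hg
      · rw [eval_map_algebraMap, ← aeval_algHom_apply, hs τ hτ]
        rfl
    rw [← coeff_map, h1, Lagrange.interpolate_apply, finsetSum_coeff]
    simp only [coeff_C_mul]
  have hbg : ∀ i, v (b i - algebraMap F L (g.coeff i)) * v t ^ i ≤ v (a - aeval t g) := by
    intro i
    have hpos : 0 < v t ^ i := pow_pos hρ i
    rw [← le_div_iff₀ hpos, hgi, hb, ← Finset.sum_sub_distrib]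
    refine v.map_sum_le fun τ hτ => ?_
    rw [← sub_mul, ← map_sub, map_mul, hv, le_div_iff₀ hpos, mul_assoc]
    exact mul_le_of_le_one_right zero_le (hcoeff τ hτ i)
  have hcg : v (∑ i ∈ Finset.range f.natDegree, algebraMap F L (c i) * t ^ i - aeval t g)
      ≤ v (a - aeval t g) := by
    rw [aeval_eq_sum_range' hg, ← Finset.sum_sub_distrib]
    refine v.map_sum_le fun i _ => ?_
    rw [Algebra.smul_def, ← sub_mul, map_mul, map_pow]
    rw [aeval_eq_sum_range' hg] at hbg
    refine le_trans ?_ (hbg i)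
    gcongr
    rw [← sub_sub_sub_cancel_left _ _ (b i)]
    exact v.map_sub_le le_rfl (hc i _)
  have := v.map_sub_le (le_refl (v (a - aeval t g))) hcg
  rwa [sub_sub_sub_cancel_right] at this

end Adjoin

/-! ### Tame bases and triviality of the ramification group -/

section Fixed

variable {F L : Type*} [Field F] [Field L] [Algebra F L]

/-- Properties of a valued field `F`, relative to an extension `B` of its valuation ring to a
Galois extension field `L`, which are inherited by tame extensions inside `L`. -/
structure IsTameBase (F : Type*) {L : Type*} [Field F] [Field L] [Algebra F L]
    (B : ValuationSubring L) : Prop where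
  invariant : ∀ (σ : L ≃ₐ[F] L) (x : L), B.valuation (σ x) = B.valuation x
  best : ∀ a : L, HasBestApprox B.valuation (Set.range (algebraMap F L)) a
  value : ∀ a : L, a ≠ 0 → ∃ m : ℕ, 0 < m ∧ B.valuation (m : L) = 1 ∧
    ∃ d : F, B.valuation a ^ m = B.valuation (algebraMap F L d)
  residue : ∀ a ∈ B, ∃ f : F[X], f.Monic ∧ (∀ i, algebraMap F L (f.coeff i) ∈ B) ∧
    B.valuation (aeval a f) < 1 ∧ B.valuation (aeval a (derivative f)) = 1

/-- Only `best` needs the condition on the conjugates of t; the other properties are inherited by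
every larger base inside L. -/
theorem IsTameBase.adjoin [IsGalois F L] {B : ValuationSubring L} (h : IsTameBase F B) {t : L}
    (ht0 : t ≠ 0)
    (ht : ∀ σ : L ≃ₐ[F] L, σ t ≠ t → B.valuation t ≤ B.valuation (σ t - t)) :
    IsTameBase F⟮t⟯ B where
  invariant σ x := h.invariant (σ.restrictScalars F) x
  best a := by
    have := hasBestApprox_adjoin B.valuation h.invariant h.best ht0 ht a
    rwa [show Set.range (algebraMap F⟮t⟯ L) = (F⟮t⟯ : Set L) from Subtype.range_coe]
  value a ha := by
    obtain ⟨m, hm, hm1, d, hd⟩ := h.value a ha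
    exact ⟨m, hm, hm1, algebraMap F F⟮t⟯ d, hd⟩
  residue a ha := by
    obtain ⟨f, hf, hfB, h0, h1⟩ := h.residue a ha
    refine ⟨f.map (algebraMap F F⟮t⟯), hf.map _, fun i => ?_, ?_, ?_⟩
    · rw [coeff_map]; exact hfB i
    · rwa [aeval_map_algebraMap]
    · rwa [derivative_map, aeval_map_algebraMap]

theorem mem_adjoin_of_forall_fixed [IsGalois F L] {a t : L}
    (h : ∀ σ : L ≃ₐ[F] L, σ a = a → σ t = t) : t ∈ F⟮a⟯ := by
  rw [← InfiniteGalois.fixedField_fixingSubgroup F⟮a⟯]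
  rintro ⟨σ, hσ⟩
  exact h σ (hσ ⟨a, mem_adjoin_simple_self F a⟩)

theorem natDegree_minpoly_adjoin_lt [IsGalois F L] {a t : L} (ht : t ∈ F⟮a⟯)
    (htF : t ∉ Set.range (algebraMap F L)) :
    (minpoly F⟮t⟯ a).natDegree < (minpoly F a).natDegree := by
  have ha : IsIntegral F a := Algebra.IsIntegral.isIntegral a
  have ht' : IsIntegral F t := Algebra.IsIntegral.isIntegral t
  have ha' : IsIntegral F⟮t⟯ a := Algebra.IsIntegral.isIntegral a
  rw [← adjoin.finrank ha, ← adjoin.finrank ha']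
  have h1 : F⟮t⟯⟮a⟯.restrictScalars F = F⟮a⟯ := by
    rw [adjoin_simple_adjoin_simple]
    refine le_antisymm ?_ ?_
    · rw [adjoin_le_iff]
      rintro x (rfl | rfl)
      · exact ht
      · exact mem_adjoin_simple_self F _
    · rw [adjoin_simple_le_iff]
      exact subset_adjoin F _ (by simp)
  have h2 := Module.finrank_mul_finrank F F⟮t⟯ F⟮t⟯⟮a⟯
  have h3 : Module.finrank F F⟮t⟯⟮a⟯ = Module.finrank F F⟮a⟯ := by
    rw [← h1]
    rfl
  have h4 : 1 < Module.finrank F F⟮t⟯ := by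
    have := adjoin.finiteDimensional ht'
    have h5 : 0 < Module.finrank F F⟮t⟯ := Module.finrank_pos
    refine lt_of_le_of_ne h5 fun h6 => htF ?_
    have h7 := finrank_adjoin_simple_eq_one_iff.1 h6.symm
    rwa [mem_bot] at h7
  have := adjoin.finiteDimensional ha'
  have h5 : 0 < Module.finrank F⟮t⟯ F⟮t⟯⟮a⟯ := Module.finrank_pos
  rw [← h3, ← h2]
  exact lt_mul_left h5 h4

/-- As `q` is a unit, 1 is a simple root of X^q − 1 modulo the maximal ideal, so no other root is
congruent to it. -/
theorem pow_eq_one_of_sub_lt {B : ValuationSubring L} {q : ℕ}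
    (hvq : B.valuation (q : L) = 1) {x : L} (hx : x ^ q = 1) (h : B.valuation (x - 1) < 1) :
    x = 1 := by
  refine eq_of_isRoot_of_sub_lt B (f := X ^ q - 1) (fun i => ?_) (one_mem B) ?_ (by simp)
    (by simp [hx]) h
  · rw [coeff_sub, coeff_X_pow, coeff_one]
    refine sub_mem ?_ ?_ <;> split_ifs <;> simp [one_mem, zero_mem]
  · simpa [derivative_X_pow] using hvq

end Fixed

/-- Over a tame base, all elements of the ramification group are trivial. -/
theorem IsTameBase.ringHom_apply_eq {L : Type u} [Field L] [IsSepClosed L]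
    {B : ValuationSubring L} (n : ℕ) : ∀ {F : Type u} [Field F] [Algebra F L] [IsGalois F L],
    IsTameBase F B → ∀ a : L, (minpoly F a).natDegree ≤ n → ∀ σ : L →+* L,
    (∀ x : F, σ (algebraMap F L x) = algebraMap F L x) →
    (∀ x : L, x ≠ 0 → B.valuation (σ x - x) < B.valuation x) → σ a = a := by
  -- The base varies in the induction, which passes from F to F(t); this is why σ is only a ring
  -- homomorphism of L.
  induction n with
  | zero =>
    intro F _ _ _ _ a ha
    have := minpoly.natDegree_pos (Algebra.IsIntegral.isIntegral (R := F) a)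
    omega
  | succ n ih =>
  intro F _ _ _ h a ha σ hσF hσ
  set v := B.valuation with hv
  set ι := algebraMap F L
  -- By Galois theory t lies in F(a). Thus F(t) is again a tame base, and the degree of `a` over it
  -- is smaller.
  have step : ∀ t : L, t ∉ Set.range ι → (∀ τ : L ≃ₐ[F] L, τ a = a → τ t = t) →
      (∀ τ : L ≃ₐ[F] L, τ t ≠ t → v t ≤ v (τ t - t)) → σ t = t → σ a = a := by
    intro t htF hta hdist hσt
    have ht0 : t ≠ 0 := by
      rintro rfl
      exact htF ⟨0, map_zero _⟩
    refine ih (h.adjoin ht0 hdist) a ?_ σ ?_ hσ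
    · have := natDegree_minpoly_adjoin_lt (mem_adjoin_of_forall_fixed hta) htF
      omega
    · rintro ⟨x, hx⟩
      obtain ⟨g, -, rfl⟩ := exists_eq_aeval_of_mem_adjoin (Algebra.IsIntegral.isIntegral t) hx
      change σ (aeval t g) = aeval t g
      rw [aeval_def, hom_eval₂, hσt]
      congr 1
      ext x
      exact hσF x
  -- The residue of u does not come from F, and it is a simple root of a polynomial over F modulo
  -- the maximal ideal. Its Hensel lift t is the only root in its residue class, so different
  -- conjugates of t are incongruent, and t inherits all symmetries of u.
  have residue_case : ∀ u : L, (∀ τ : L ≃ₐ[F] L, τ a = a → τ u = u) → u ∈ B →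
      (∀ e : F, 1 ≤ v (u - ι e)) → σ a = a := by
    intro u hua huB hue
    obtain ⟨f, hf, hfB, h0, h1⟩ := h.residue u huB
    set fL := f.map ι with hfL
    have hfLB : ∀ i, fL.coeff i ∈ B := fun i => by rw [coeff_map]; exact hfB i
    have hfLB' : ∀ i, fL.derivative.coeff i ∈ B := fun i => by
      rw [coeff_derivative]
      exact mul_mem (hfLB _) (add_mem (natCast_mem B i) (one_mem B))
    rw [← eval_map_algebraMap] at h0 h1
    rw [← derivative_map] at h1
    obtain ⟨t, ht, htu⟩ := exists_root_close_of_isSepClosed B (hf.map ι) hfLB huB h0 h1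
    have htB : t ∈ B := by
      have := add_mem ((B.valuation_le_one_iff _).1 htu.le) huB
      rwa [sub_add_cancel] at this
    have htder : v (fL.derivative.eval t) = 1 := valuation_eval_eq_one B hfLB' htB huB htu h1
    have huniq : ∀ s : L, fL.eval s = 0 → v (s - t) < 1 → s = t := fun s hs hst =>
      eq_of_isRoot_of_sub_lt B hfLB htB htder ht hs hst
    have hroot : ∀ τ : L →+* L, (∀ x : F, τ (ι x) = ι x) → fL.eval (τ t) = 0 := by
      intro τ hτ
      have : τ.comp ι = ι := by
        ext x
        exact hτ x
      have h2 := congrArg τ ht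
      rw [eval_map, hom_eval₂, this, map_zero] at h2
      rw [hfL, eval_map, h2]
    have hvt : v t ≤ 1 := (B.valuation_le_one_iff _).2 htB
    refine step t ?_ ?_ ?_ ?_
    · rintro ⟨e, rfl⟩
      rw [B.valuation.map_sub_swap] at htu
      exact absurd htu (not_lt.2 (hue e))
    · intro τ hτ
      refine huniq _ (hroot (τ : L →+* L) τ.commutes) ?_
      have h2 : v (τ t - u) < 1 := by
        rw [← hua τ hτ, ← map_sub, h.invariant]
        exact htu
      have := v.map_sub_lt h2 htu
      rwa [sub_sub_sub_cancel_right] at this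
    · intro τ hτ
      by_contra hcon
      exact hτ (huniq _ (hroot (τ : L →+* L) τ.commutes) ((not_le.1 hcon).trans_le hvt))
    · refine huniq _ (hroot σ hσF) ((hσ t ?_).trans_le hvt)
      rintro rfl
      have := hue 0
      rw [map_zero, sub_zero] at this
      rw [zero_sub, B.valuation.map_neg] at htu
      exact absurd htu (not_lt.2 this)
  by_cases haF : a ∈ Set.range ι
  · obtain ⟨x, rfl⟩ := haF
    exact hσF x
  -- No element of F improves on a' = a − c. So if v(a') is attained in F, the scaled a' has a new
  -- residue; otherwise v(a') itself is new.
  obtain ⟨_, ⟨c, rfl⟩, hc⟩ := h.best a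
  set a' := a - ι c with ha'
  have ha'0 : a' ≠ 0 := fun h0 => haF ⟨c, (sub_eq_zero.1 h0).symm⟩
  have ha'fix : ∀ τ : L ≃ₐ[F] L, τ a = a → τ a' = a' := fun τ hτ => by
    rw [ha', map_sub, hτ, τ.commutes]
  have hbest : ∀ d : F, v a' ≤ v (a' - ι d) := fun d => by
    have := hc (ι (c + d)) ⟨_, rfl⟩
    rwa [map_add, ← sub_sub] at this
  by_cases hval : ∃ e : F, v a' = v (ι e)
  · obtain ⟨e, he⟩ := hval
    have hva' : v a' ≠ 0 := v.ne_zero_iff.2 ha'0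
    have hve : 0 < v (ι e) := zero_lt_iff.2 (he ▸ hva')
    have he0 : ι e ≠ 0 := v.pos_iff.1 hve
    refine residue_case (a' / ι e) (fun τ hτ => ?_) ?_ fun d => ?_
    · rw [map_div₀, ha'fix τ hτ, τ.commutes]
    · rw [← B.valuation_le_one_iff, map_div₀, ← hv, he, div_self hve.ne']
    · have e1 : a' / ι e - ι d = (a' - ι (d * e)) / ι e := by
        rw [map_mul]; field_simp
      rw [e1, map_div₀, one_le_div₀ hve, ← he]
      exact hbest _
  have hex := h.value a' ha'0
  classical
  set m := Nat.find hex with hm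
  obtain ⟨hm0, hvm, d, hd⟩ := Nat.find_spec hex
  rw [← hm] at hm0 hvm hd
  have hm1 : m ≠ 1 := by
    intro h1
    rw [h1, pow_one] at hd
    exact hval ⟨d, hd⟩
  obtain ⟨q, hq, l, hl⟩ := Nat.exists_prime_and_dvd hm1
  have hl0 : 0 < l := Nat.pos_of_ne_zero (by rintro rfl; omega)
  have hlm : l < m := by
    rw [hl]
    exact lt_mul_left hl0 hq.one_lt
  have hnat : ∀ k : ℕ, v (k : L) ≤ 1 := fun k => (B.valuation_le_one_iff _).2 (natCast_mem B k)
  have hvql : v (q : L) = 1 ∧ v (l : L) = 1 := by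
    have h1 : v (q : L) * v (l : L) = 1 := by
      rw [← map_mul, ← Nat.cast_mul, ← hl]; exact hvm
    refine ⟨le_antisymm (hnat q) ?_, le_antisymm (hnat l) ?_⟩
    · rw [← h1]; exact mul_le_of_le_one_right zero_le (hnat l)
    · rw [← h1]; exact mul_le_of_le_one_left zero_le (hnat q)
  -- By minimality of m = ql, the value of b is not attained in F, while its q-th power is.
  set b := a' ^ l with hb
  have hb0 : b ≠ 0 := pow_ne_zero _ ha'0
  have hbF : ∀ e : F, v b ≠ v (ι e) := fun e he => by
    refine Nat.find_min hex hlm ⟨hl0, hvql.2, e, ?_⟩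
    rw [← he, hb, map_pow]
  have hbq : v (b ^ q) = v (ι d) := by
    rw [hb, ← pow_mul, mul_comm l q, ← hl, map_pow]
    exact hd
  have hvd : 0 < v (ι d) := by
    rw [← hbq]
    exact v.pos_iff.2 (pow_ne_zero _ hb0)
  have hd0 : ι d ≠ 0 := v.pos_iff.1 hvd
  have hbfix : ∀ τ : L ≃ₐ[F] L, τ a = a → τ b = b := fun τ hτ => by
    rw [hb, map_pow, ha'fix τ hτ]
  have hu1 : v (b ^ q / ι d) = 1 := by rw [map_div₀, hbq, div_self hvd.ne']
  have hufix : ∀ τ : L ≃ₐ[F] L, τ a = a → τ (b ^ q / ι d) = b ^ q / ι d := fun τ hτ => by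
    rw [map_div₀, map_pow, hbfix τ hτ, τ.commutes]
  -- If the unit b^q/d has a residue from F, dividing b by a q-th root s congruent to 1 gives an
  -- element with q-th power in F, whose conjugates differ by q-th roots of unity. Otherwise the
  -- residue is new.
  by_cases hres : ∃ e : F, v (b ^ q / ι d - ι e) < 1
  · obtain ⟨e, he⟩ := hres
    have hve : v (ι e) = 1 := by
      rw [← hu1]
      refine v.map_eq_of_sub_lt ?_
      rwa [v.map_sub_swap, hu1]
    have he0 : ι e ≠ 0 := v.ne_zero_iff.1 (by rw [hve]; exact one_ne_zero)
    set w := b ^ q / ι d / ι e with hw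
    have hwB : w ∈ B := by
      rw [← B.valuation_le_one_iff, ← hv, hw, map_div₀, hu1, hve, div_one]
    have hfB : ∀ i, (X ^ q - C w).coeff i ∈ B := fun i => by
      rw [coeff_sub, coeff_X_pow, coeff_C]
      refine sub_mem ?_ ?_ <;> split_ifs <;> simp [one_mem, zero_mem, hwB]
    obtain ⟨s, hs, hs1⟩ := exists_root_close_of_isSepClosed B (monic_X_pow_sub_C w hq.ne_zero) hfB
      (one_mem B)
      (by
        rw [eval_sub, eval_pow, eval_X, eval_C, one_pow]
        have e1 : 1 - w = -((b ^ q / ι d - ι e) / ι e) := by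
          rw [hw]; field_simp; ring
        rw [e1, B.valuation.map_neg, map_div₀, ← hv, hve, div_one]
        exact he)
      (by simpa [derivative_X_pow] using hvql.1)
    have hsq : s ^ q = w := by simpa [sub_eq_zero] using hs
    have hvs : v s = 1 := by
      have := eq_of_sub_lt v (x := s) (y := 1) (by rwa [map_one])
      rwa [map_one] at this
    have hs0 : s ≠ 0 := v.ne_zero_iff.1 (by rw [hvs]; exact one_ne_zero)
    have ht0 : b / s ≠ 0 := div_ne_zero hb0 hs0
    have htq : (b / s) ^ q = ι (d * e) := by
      rw [div_pow, hsq, hw, map_mul]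
      have := pow_ne_zero q hb0
      field_simp
    have hroot : ∀ τ : L →+* L, (∀ x : F, τ (ι x) = ι x) → (τ (b / s) / (b / s)) ^ q = 1 := by
      intro τ hτ
      rw [div_pow, ← map_pow, htq, hτ, div_self]
      rw [map_mul]
      exact mul_ne_zero hd0 he0
    refine step (b / s) ?_ ?_ ?_ ?_
    · rintro ⟨k, hk⟩
      refine hbF k ?_
      rw [hk, map_div₀, hvs, div_one]
    · intro τ hτ
      have hτs : τ s / s = 1 := by
        refine pow_eq_one_of_sub_lt hvql.1 ?_ ?_
        · rw [div_pow, ← map_pow, hsq, hw, map_div₀, hufix τ hτ, τ.commutes, div_self]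
          rw [← hw, ← hsq]
          exact pow_ne_zero _ hs0
        · have e1 : τ s / s - 1 = (τ s - s) / s := by field_simp
          rw [e1, map_div₀, ← hv, hvs, div_one]
          have h2 : v (τ s - 1) < 1 := by
            have := h.invariant τ (s - 1)
            rw [map_sub, map_one] at this
            rw [hv, this]
            exact hs1
          have := v.map_sub_lt h2 hs1
          rwa [sub_sub_sub_cancel_right] at this
      rw [map_div₀, hbfix τ hτ, (div_eq_one_iff_eq hs0).1 hτs]
    · intro τ hτ
      by_contra hcon
      refine hτ ?_
      have hvt : 0 < v (b / s) := v.pos_iff.2 ht0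
      refine (div_eq_one_iff_eq ht0).1 (pow_eq_one_of_sub_lt hvql.1
        (hroot (τ : L →+* L) τ.commutes) ?_)
      have e1 : τ (b / s) / (b / s) - 1 = (τ (b / s) - b / s) / (b / s) := by
        rw [sub_div, div_self ht0]
      rw [e1, map_div₀, ← hv, div_lt_one₀ hvt]
      exact not_le.1 hcon
    · have hvt : 0 < v (b / s) := v.pos_iff.2 ht0
      refine (div_eq_one_iff_eq ht0).1 (pow_eq_one_of_sub_lt hvql.1 (hroot σ hσF) ?_)
      have e1 : σ (b / s) / (b / s) - 1 = (σ (b / s) - b / s) / (b / s) := by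
        rw [sub_div, div_self ht0]
      rw [e1, map_div₀, ← hv, div_lt_one₀ hvt]
      exact hσ _ ht0
  · push Not at hres
    exact residue_case _ hufix ((B.valuation_le_one_iff _).1 hu1.le) hres

/-! ### Consequences of p-divisible values and a perfect residue field -/

section ResidueCharacteristic

variable {K L : Type*} [Field K] [Field L] [Algebra K L]

theorem natCast_valuation_lt_one_iff (A : ValuationSubring K) (n : ℕ) :
    A.valuation (n : K) < 1 ↔ (n : IsLocalRing.ResidueField A) = 0 := by
  have h := A.valuation_lt_one_iff (n : A)
  rw [← IsLocalRing.residue_eq_zero_iff, map_natCast] at h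
  exact h.symm

theorem natCast_valuation_eq_one_iff (A : ValuationSubring K) (n : ℕ) :
    A.valuation (n : K) = 1 ↔ (n : IsLocalRing.ResidueField A) ≠ 0 := by
  rw [ne_eq, ← natCast_valuation_lt_one_iff, not_lt]
  exact ⟨fun h => h.ge, fun h => le_antisymm ((A.valuation_le_one_iff _).2 (natCast_mem A n)) h⟩

theorem IsValueGroupDivisible.exists_pow_eq {A : ValuationSubring K} {n : ℕ}
    (h : IsValueGroupDivisible A n) {d : K} (hd : d ≠ 0) :
    ∃ e : K, e ≠ 0 ∧ A.valuation e ^ n = A.valuation d := by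
  obtain ⟨δ, hδ⟩ := h (Units.mk0 (A.valuation d) (A.valuation.ne_zero_iff.2 hd))
  obtain ⟨e, he⟩ := A.valuation_surjective δ
  refine ⟨e, A.valuation.ne_zero_iff.1 (he ▸ δ.ne_zero), ?_⟩
  rw [he, ← Units.val_pow_eq_pow_val, hδ]
  rfl

theorem isValueGroupDivisible_of_forall {A : ValuationSubring K} {n : ℕ}
    (h : ∀ d : K, d ≠ 0 → ∃ e : K, A.valuation e ^ n = A.valuation d) :
    IsValueGroupDivisible A n := by
  rcases n.eq_zero_or_pos with rfl | hn
  · intro γ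
    obtain ⟨d, hd⟩ := A.valuation_surjective γ
    obtain ⟨e, he⟩ := h d (A.valuation.ne_zero_iff.1 (hd ▸ γ.ne_zero))
    refine ⟨1, Units.ext ?_⟩
    rw [← hd, ← he]
    simp
  · intro γ
    obtain ⟨d, hd⟩ := A.valuation_surjective γ
    obtain ⟨e, he⟩ := h d (A.valuation.ne_zero_iff.1 (hd ▸ γ.ne_zero))
    have he0 : A.valuation e ≠ 0 := by
      intro h0
      rw [h0, zero_pow hn.ne', hd] at he
      exact γ.ne_zero he.symm
    refine ⟨Units.mk0 _ he0, Units.ext ?_⟩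
    simp [he, hd]

/-- If the value group of `K` is divisible by the residue characteristic exponent, then the value
group of an algebraic extension has no torsion of that order modulo the value group of `K`. -/
theorem IsValueGroupDivisible.exists_pow_valuation_eq [Algebra.IsAlgebraic K L]
    {B : ValuationSubring L} {p : ℕ}
    [hp : ExpChar (IsLocalRing.ResidueField (B.comap (algebraMap K L))) p]
    (h : IsValueGroupDivisible (B.comap (algebraMap K L)) p) {a : L} (ha : a ≠ 0) :
    ∃ m : ℕ, 0 < m ∧ B.valuation (m : L) = 1 ∧
      ∃ d : K, B.valuation a ^ m = B.valuation (algebraMap K L d) := by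
  set A := B.comap (algebraMap K L)
  have hequiv := comap_valuation_isEquiv B (algebraMap K L)
  have hnat : ∀ n : ℕ, (n : IsLocalRing.ResidueField A) ≠ 0 → B.valuation (n : L) = 1 := by
    intro n hn
    rw [← natCast_valuation_eq_one_iff, hequiv.eq_one_iff_eq_one] at hn
    rwa [← map_natCast (algebraMap K L)]
  obtain ⟨m, hm, d, hd, hmd⟩ := ValuedPlace.exists_pow_valuation_eq (K := K) B.valuation
    (Algebra.IsAlgebraic.isAlgebraic a) ha
  cases hp with
  | zero => exact ⟨m, hm, hnat m (by exact_mod_cast hm.ne'), d, hmd⟩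
  | prime hprime =>
    -- The p-part of m is removed by extracting p^e-th roots in the value group of K; such roots are
    -- unique in an ordered group.
    obtain ⟨e, l, hl, hml⟩ := Nat.exists_eq_pow_mul_and_not_dvd hm.ne' p hprime.ne_one
    have hdiv : ∀ k : ℕ, ∃ c : K, c ≠ 0 ∧ A.valuation (c ^ p ^ k) = A.valuation d := by
      intro k
      induction k with
      | zero => exact ⟨d, hd, by simp⟩
      | succ k ih =>
        obtain ⟨c, hc, hcd⟩ := ih
        obtain ⟨c', hc', hcc⟩ := h.exists_pow_eq hc
        refine ⟨c', hc', ?_⟩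
        rw [pow_succ', pow_mul, map_pow, map_pow, hcc, ← map_pow, hcd]
    obtain ⟨c, -, hc⟩ := hdiv e
    refine ⟨l, Nat.pos_of_ne_zero (by rintro rfl; simp at hl), hnat l ?_, c, ?_⟩
    · rwa [ne_eq, CharP.cast_eq_zero_iff _ p]
    · have h1 := hequiv.eq_iff.1 hc
      change B.valuation (algebraMap K L (c ^ p ^ e)) = B.valuation (algebraMap K L d) at h1
      rw [← hmd, hml, map_pow, map_pow, mul_comm, pow_mul] at h1
      exact ((pow_left_inj₀ zero_le zero_le (pow_pos hprime.pos e).ne').1 h1).symm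

/-- The canonical embedding of residue fields, and its compatibility with the evaluation of
polynomials. -/
theorem exists_residueField_ringHom {A : ValuationSubring K} {B : ValuationSubring L}
    (hA : B.comap (algebraMap K L) = A) :
    ∃ ψ : IsLocalRing.ResidueField A →+* IsLocalRing.ResidueField B,
      ∀ (G : A[X]) (a : B), ∃ c : B, (c : L) = aeval (a : L) (G.map (algebraMap A K)) ∧
        IsLocalRing.residue B c =
          eval₂ ψ (IsLocalRing.residue B a) (G.map (IsLocalRing.residue A)) := by
  subst hA
  set A := B.comap (algebraMap K L) with hA
  have hequiv := comap_valuation_isEquiv B (algebraMap K L)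
  let φ : A →+* B := ((algebraMap K L).comp A.subtype).codRestrict B.toSubring fun x => x.2
  have : IsLocalHom φ := ⟨fun x hx => by
    rw [ValuationSubring.valuation_eq_one_iff] at hx ⊢
    exact hequiv.eq_one_iff_eq_one.2 hx⟩
  refine ⟨IsLocalRing.ResidueField.map φ, fun G a => ⟨eval₂ φ a G, ?_, ?_⟩⟩
  · rw [← ValuationSubring.algebraMap_apply, hom_eval₂, aeval_def, eval₂_map]
    rfl
  · rw [eval₂_map, IsLocalRing.ResidueField.map_comp_residue, hom_eval₂]

/-- If the residue field of `K` is perfect, then the residues of a Galois extension are simple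
roots of polynomials over the residue field of `K`. -/
theorem exists_simple_root_mod [Normal K L] {B : ValuationSubring L}
    [PerfectField (IsLocalRing.ResidueField (B.comap (algebraMap K L)))]
    (hinv : ∀ (σ : L ≃ₐ[K] L) (x : L), B.valuation (σ x) = B.valuation x) {a : L} (ha : a ∈ B) :
    ∃ f : K[X], f.Monic ∧ (∀ i, algebraMap K L (f.coeff i) ∈ B) ∧
      B.valuation (aeval a f) < 1 ∧ B.valuation (aeval a (derivative f)) = 1 := by
  set A := B.comap (algebraMap K L) with hA
  obtain ⟨ψ, hψ⟩ := exists_residueField_ringHom hA.symm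
  let := ψ.toAlgebra
  set α := IsLocalRing.residue B ⟨a, ha⟩
  have hint : IsIntegral (IsLocalRing.ResidueField A) α := by
    have hl : minpoly K a ∈ lifts (algebraMap A K) := by
      rw [lifts_iff_coeff_lifts]
      refine fun i => ⟨⟨_, coeff_minpoly_mem B (fun σ => ?_) i⟩, rfl⟩
      rw [← B.valuation_le_one_iff, hinv, B.valuation_le_one_iff]
      exact ha
    obtain ⟨G, hG, -, hGm⟩ := lifts_and_natDegree_eq_and_monic hl
      (minpoly.monic (Normal.isIntegral ‹_› a))
    refine ⟨G.map (IsLocalRing.residue A), hGm.map _, ?_⟩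
    obtain ⟨c, hc, hc'⟩ := hψ G ⟨a, ha⟩
    have hc0 : c = 0 := by
      apply Subtype.ext
      rw [hc, hG, minpoly.aeval]
      rfl
    rw [hc0, map_zero] at hc'
    exact hc'.symm
  have hsep : IsSeparable (IsLocalRing.ResidueField A) α :=
    PerfectField.separable_of_irreducible (minpoly.irreducible hint)
  -- A monic lift of the minimal polynomial of the residue, which is separable because the residue
  -- field is perfect.
  obtain ⟨G, hG, -, hGm⟩ := lifts_and_natDegree_eq_and_monic
    ((mem_lifts _).2 (map_surjective _ IsLocalRing.residue_surjective _)) (minpoly.monic hint)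
  refine ⟨G.map (algebraMap A K), hGm.map _, fun i => ?_, ?_, ?_⟩
  · rw [coeff_map]
    exact (G.coeff i).2
  · obtain ⟨c, hc, hc'⟩ := hψ G ⟨a, ha⟩
    rw [hG] at hc'
    rw [← hc, ← ValuationSubring.valuation_lt_one_iff, ← IsLocalRing.residue_eq_zero_iff, hc']
    exact minpoly.aeval _ α
  · obtain ⟨c, hc, hc'⟩ := hψ (derivative G) ⟨a, ha⟩
    rw [← derivative_map, hG] at hc'
    rw [derivative_map, ← hc, ← ValuationSubring.valuation_eq_one_iff,
      ← IsLocalRing.residue_ne_zero_iff_isUnit, hc']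
    exact Separable.aeval_derivative_ne_zero hsep (minpoly.aeval _ _)

end ResidueCharacteristic

theorem isSeparablyTame_of_isSeparableAlgebraicallyMaximal {K : Type u} [Field K]
    {A : ValuationSubring K} (hmax : IsSeparableAlgebraicallyMaximal A)
    (hdiv : IsValueGroupDivisible A (ringExpChar (IsLocalRing.ResidueField A)))
    [hperf : PerfectField (IsLocalRing.ResidueField A)] : IsSeparablyTame A := by
  have hhens : IsHenselian A := by
    obtain ⟨B, hB⟩ := exists_extension (L := AlgebraicClosure K) A
    exact isHenselian_of_hasBestApprox hB fun a ha => hmax.hasBestApprox hB ha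
  refine ⟨hhens, fun B hB => ?_⟩
  -- Best approximations are available for places of the algebraic closure, so `B` is extended there
  -- and the inequalities are pulled back.
  obtain ⟨C, hC⟩ := exists_extension (L := AlgebraicClosure K) B
  have hCA : C.comap (algebraMap K (AlgebraicClosure K)) = A := by
    rw [← hB, ← hC, ValuationSubring.comap_comap, ← IsScalarTower.algebraMap_eq]
  have hequiv := comap_valuation_isEquiv C (algebraMap (SeparableClosure K) (AlgebraicClosure K))
  rw [hC] at hequiv
  subst hB
  have hinv := hhens.valuation_algEquiv_apply
  have hbase : IsTameBase K B :=
    { invariant := hinv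
      best := fun a => by
        obtain ⟨_, ⟨c, rfl⟩, hc⟩ := hmax.hasBestApprox hCA
          (a := algebraMap (SeparableClosure K) (AlgebraicClosure K) a)
          ((Algebra.IsSeparable.isSeparable K a).map
            (IsScalarTower.toAlgHom K (SeparableClosure K) (AlgebraicClosure K))
            (algebraMap (SeparableClosure K) (AlgebraicClosure K)).injective)
        refine ⟨_, ⟨c, rfl⟩, ?_⟩
        rintro _ ⟨d, rfl⟩
        exact hequiv.le_iff_le.2 (hc _ ⟨d, rfl⟩)
      value := fun a ha => hdiv.exists_pow_valuation_eq ha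
      residue := fun a ha => exists_simple_root_mod hinv ha }
  have htriv : ∀ σ ∈ ramificationGroup K B, σ = 1 := by
    rintro σ ⟨-, hσ⟩
    refine AlgEquiv.ext fun a => ?_
    refine hbase.ringHom_apply_eq _ a le_rfl (σ : SeparableClosure K →+* SeparableClosure K)
      σ.commutes fun x hx => ?_
    have h1 := hσ x hx
    have e1 : σ x / x - 1 = (σ x - x) / x := by rw [sub_div, div_self hx]
    rwa [e1, map_div₀, div_lt_one₀ (B.valuation.pos_iff.2 hx)] at h1
  rw [eq_top_iff]
  rintro a - ⟨σ, hσ⟩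
  exact DFunLike.congr_fun (htriv σ hσ) a

/-! ### Inertia and wild inertia in Galois extensions -/

section FiniteLevel

variable {K L : Type*} [Field K] [Field L] [Algebra K L]

theorem residue_eq_iff {B : ValuationSubring L} {x y : B} :
    IsLocalRing.residue B x = IsLocalRing.residue B y ↔ B.valuation ((x : L) - y) < 1 := by
  rw [← sub_eq_zero, ← map_sub, IsLocalRing.residue_eq_zero_iff,
    ValuationSubring.valuation_lt_one_iff]
  rfl

/-- Frobenius is injective on the residue field. -/
theorem valuation_sub_lt_one_of_pow {B : ValuationSubring L} (p : ℕ) [Fact p.Prime]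
    [CharP (IsLocalRing.ResidueField B) p] (n : ℕ) {x y : L} (hx : x ∈ B) (hy : y ∈ B)
    (h : B.valuation (x ^ p ^ n - y ^ p ^ n) < 1) : B.valuation (x - y) < 1 := by
  have h1 := (residue_eq_iff (x := (⟨x, hx⟩ : B) ^ p ^ n) (y := (⟨y, hy⟩ : B) ^ p ^ n)).2 h
  rw [map_pow, map_pow] at h1
  exact (residue_eq_iff (x := (⟨x, hx⟩ : B)) (y := ⟨y, hy⟩)).1
    (iterateFrobenius_inj (IsLocalRing.ResidueField B) p n h1)

theorem map_mem_of_mem {B : ValuationSubring L}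
    (hinv : ∀ (σ : L ≃ₐ[K] L) (x : L), B.valuation (σ x) = B.valuation x)
    (σ : L ≃ₐ[K] L) {a : L} (ha : a ∈ B) : σ a ∈ B := by
  rw [← B.valuation_le_one_iff, hinv, B.valuation_le_one_iff]
  exact ha

variable {B : ValuationSubring L}
  (hinv : ∀ (σ : L ≃ₐ[K] L) (x : L), B.valuation (σ x) = B.valuation x)

/-- The automorphisms acting trivially on the residue field, for a Galois invariant place. -/
def inertiaGroup : Subgroup (L ≃ₐ[K] L) where
  carrier := {σ | ∀ a ∈ B, B.valuation (σ a - a) < 1}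
  one_mem' := fun a _ => by simp
  mul_mem' := by
    intro σ τ hσ hτ a ha
    have e : (σ * τ) a - a = σ (τ a - a) + (σ a - a) := by rw [map_sub, AlgEquiv.mul_apply]; ring
    rw [e]
    refine B.valuation.map_add_lt ?_ (hσ a ha)
    rw [hinv]
    exact hτ a ha
  inv_mem' := by
    intro σ hσ a ha
    rw [← hinv σ, map_sub, show σ (σ⁻¹ a) = a from σ.apply_symm_apply a, B.valuation.map_sub_swap]
    exact hσ a ha

/-- The automorphisms `σ` such that `σ a / a` has residue `1` for all `a ≠ 0`, for a Galois
invariant place. -/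
def wildGroup : Subgroup (L ≃ₐ[K] L) where
  carrier := {σ | ∀ a, a ≠ 0 → B.valuation (σ a - a) < B.valuation a}
  one_mem' := fun a ha => by simpa using B.valuation.pos_iff.2 ha
  mul_mem' := by
    intro σ τ hσ hτ a ha
    have e : (σ * τ) a - a = σ (τ a - a) + (σ a - a) := by rw [map_sub, AlgEquiv.mul_apply]; ring
    rw [e]
    refine B.valuation.map_add_lt ?_ (hσ a ha)
    rw [hinv]
    exact hτ a ha
  inv_mem' := by
    intro σ hσ a ha
    rw [← hinv σ, map_sub, show σ (σ⁻¹ a) = a from σ.apply_symm_apply a, B.valuation.map_sub_swap]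
    exact hσ a ha

theorem wildGroup_le_inertiaGroup : wildGroup hinv ≤ inertiaGroup hinv := by
  intro σ hσ a ha
  rcases eq_or_ne a 0 with rfl | h0
  · simp
  · exact (hσ a h0).trans_le ((B.valuation_le_one_iff _).2 ha)

/-- Normality makes the fixed field of the wild group a normal extension of K, to which
automorphisms restrict. -/
instance wildGroup_normal : (wildGroup hinv).Normal where
  conj_mem σ hσ τ a ha := by
    have h1 := hσ (τ⁻¹ a) (by simpa using ha)
    rw [← hinv τ, map_sub, hinv τ⁻¹, show τ (τ⁻¹ a) = a from τ.apply_symm_apply a] at h1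
    exact h1

/-- Inertia modulo wild inertia has no p-torsion: for `σ` in the inertia group, σ^n(a)/a is
congruent to the n-th power of σ(a)/a, and 1 is the only p-th root of 1 in characteristic p. -/
theorem mem_wildGroup_of_pow_mem {p : ℕ} [Fact p.Prime] [CharP (IsLocalRing.ResidueField B) p]
    {σ : L ≃ₐ[K] L} (hσ : σ ∈ inertiaGroup hinv) (hp : σ ^ p ∈ wildGroup hinv) :
    σ ∈ wildGroup hinv := by
  intro a ha
  have hva : 0 < B.valuation a := B.valuation.pos_iff.2 ha
  set c := σ a / a with hc
  have hcB : c ∈ B := by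
    rw [← B.valuation_le_one_iff, hc, map_div₀, hinv, div_self hva.ne']
  have key : ∀ n : ℕ, (σ ^ n) a / a ∈ B ∧ B.valuation ((σ ^ n) a / a - c ^ n) < 1 := by
    intro n
    induction n with
    | zero => simp [div_self ha, one_mem]
    | succ n ih =>
      have hσn := (inertiaGroup hinv).pow_mem hσ n
      have e : (σ ^ (n + 1)) a / a = (σ ^ n) c * ((σ ^ n) a / a) := by
        have : (σ ^ n) a ≠ 0 := (map_ne_zero_iff _ (σ ^ n).injective).2 ha
        rw [pow_succ, AlgEquiv.mul_apply, hc, map_div₀]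
        field_simp
      have h1 : (σ ^ n) c ∈ B := map_mem_of_mem hinv _ hcB
      refine ⟨e ▸ mul_mem h1 ih.1, ?_⟩
      have h2 := (residue_eq_iff (x := (⟨_, h1⟩ : B)) (y := ⟨c, hcB⟩)).2 (hσn c hcB)
      have h3 := (residue_eq_iff (x := (⟨_, ih.1⟩ : B)) (y := (⟨c, hcB⟩ : B) ^ n)).2 ih.2
      have h4 : IsLocalRing.residue B (⟨_, h1⟩ * ⟨_, ih.1⟩)
          = IsLocalRing.residue B (⟨c, hcB⟩ ^ (n + 1)) := by
        rw [map_mul, h2, h3, pow_succ', map_mul]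
      rw [e]
      exact residue_eq_iff.1 h4
  have h1 := key p
  have h2 : B.valuation ((σ ^ p) a / a - 1) < 1 := by
    rw [show (σ ^ p) a / a - 1 = ((σ ^ p) a - a) / a by rw [sub_div, div_self ha], map_div₀,
      div_lt_one₀ hva]
    exact hp a ha
  have h3 := B.valuation.map_sub_lt h2 h1.2
  rw [sub_sub_sub_cancel_left] at h3
  have h4 := valuation_sub_lt_one_of_pow p 1 hcB (one_mem B) (by simpa using h3)
  rw [show c - 1 = (σ a - a) / a by rw [sub_div, div_self ha], map_div₀, div_lt_one₀ hva] at h4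
  exact h4

/-- Averaging: x = y minus the mean of its orbit has orbit sum 0. This sum is also lx plus terms of
value less than v(x), so x = 0 and y is fixed. -/
theorem eq_one_of_mem_wildGroup {σ : L ≃ₐ[K] L} (hσ : σ ∈ wildGroup hinv) {l : ℕ}
    (hl : B.valuation (l : L) = 1) (hσl : σ ^ l = 1) : σ = 1 := by
  have hl0 : (l : L) ≠ 0 := B.valuation.ne_zero_iff.1 (by rw [hl]; exact one_ne_zero)
  refine AlgEquiv.ext fun y => ?_
  set s := ∑ i ∈ Finset.range l, (σ ^ i) y with hs
  have hσs : σ s = s := by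
    have e : σ s = ∑ i ∈ Finset.range l, (σ ^ (i + 1)) y := by
      rw [hs, map_sum]
      exact Finset.sum_congr rfl fun i _ => by rw [pow_succ', AlgEquiv.mul_apply]
    have h1 := Finset.sum_range_succ (fun i => (σ ^ i) y) l
    rw [Finset.sum_range_succ', hσl, pow_zero] at h1
    rw [e]
    exact add_right_cancel h1
  set x := y - s / l with hx
  have hσis : ∀ i : ℕ, (σ ^ i) s = s := by
    intro i
    induction i with
    | zero => rfl
    | succ i ih => rw [pow_succ, AlgEquiv.mul_apply, hσs, ih]
  have hsum : ∑ i ∈ Finset.range l, (σ ^ i) x = 0 := by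
    rw [hx]
    simp only [map_sub, map_div₀, map_natCast, hσis]
    rw [Finset.sum_sub_distrib, ← hs, Finset.sum_const, Finset.card_range, nsmul_eq_mul]
    field_simp
    ring
  have hx0 : x = 0 := by
    by_contra hne
    have hvx : 0 < B.valuation x := B.valuation.pos_iff.2 hne
    have h1 : B.valuation (∑ i ∈ Finset.range l, ((σ ^ i) x - x)) < B.valuation x :=
      B.valuation.map_sum_lt' hvx fun i _ => (wildGroup hinv).pow_mem hσ i x hne
    rw [Finset.sum_sub_distrib, hsum, zero_sub, B.valuation.map_neg, Finset.sum_const,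
      Finset.card_range, nsmul_eq_mul, map_mul, hl, one_mul] at h1
    exact lt_irrefl _ h1
  have hy : y = s / l := sub_eq_zero.1 hx0
  change σ y = y
  rw [hy, map_div₀, hσs, map_natCast]

theorem exists_card_wildGroup_eq_pow [FiniteDimensional K L] {p : ℕ} [Fact p.Prime]
    [CharP (IsLocalRing.ResidueField B) p] : ∃ n, Nat.card (wildGroup hinv) = p ^ n := by
  refine ⟨_, Nat.eq_prime_pow_of_unique_prime_dvd Nat.card_pos.ne' fun {l} hl hdvd => ?_⟩
  by_contra hne
  have := Fact.mk hl
  obtain ⟨σ, hσ⟩ := exists_prime_orderOf_dvd_card' l hdvd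
  have hvl : B.valuation (l : L) = 1 := by
    rw [natCast_valuation_eq_one_iff, ne_eq, CharP.cast_eq_zero_iff _ p,
      Nat.prime_dvd_prime_iff_eq (Fact.out : p.Prime) hl]
    exact fun h => hne h.symm
  have h1 := eq_one_of_mem_wildGroup hinv σ.2 hvl
    (by rw [← hσ]; exact_mod_cast congrArg Subtype.val (pow_orderOf_eq_one σ))
  have h2 : σ = 1 := Subtype.ext h1
  rw [h2, orderOf_one] at hσ
  exact hl.one_lt.ne hσ

/-- The residue field extension of `L` over the fixed field of the wild group is purely
inseparable. -/
theorem mem_inertiaGroup_of_forall_fixed [FiniteDimensional K L] {p : ℕ} [Fact p.Prime]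
    [CharP (IsLocalRing.ResidueField B) p] {σ : L ≃ₐ[K] L}
    (h : ∀ z ∈ B, (∀ ρ ∈ wildGroup hinv, ρ z = z) → B.valuation (σ z - z) < 1) :
    σ ∈ inertiaGroup hinv := by
  classical
  intro y hy
  obtain ⟨n, hn⟩ := exists_card_wildGroup_eq_pow (p := p) hinv
  set W := wildGroup hinv
  have hρB : ∀ ρ : W, (ρ : L ≃ₐ[K] L) y ∈ B := fun ρ => map_mem_of_mem hinv _ hy
  -- All factors are congruent to y, so z is congruent to y^(p^n); moreover z is fixed by W. The
  -- congruence of σz and z descends to σy and y by injectivity of Frobenius.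
  set z : L := ∏ ρ : W, (ρ : L ≃ₐ[K] L) y with hz
  have hzB : z ∈ B := prod_mem fun ρ _ => hρB ρ
  have hzfix : ∀ ρ ∈ W, ρ z = z := by
    intro ρ hρ
    rw [hz, map_prod]
    exact Fintype.prod_equiv (Equiv.mulLeft (⟨ρ, hρ⟩ : W)) _ _ fun _ => rfl
  have hzy : B.valuation (z - y ^ p ^ n) < 1 := by
    have h1 : IsLocalRing.residue B (∏ ρ : W, ⟨_, hρB ρ⟩)
        = IsLocalRing.residue B (⟨y, hy⟩ ^ p ^ n) := by
      rw [map_prod, map_pow, ← hn, Nat.card_eq_fintype_card, ← Finset.card_univ]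
      refine Finset.prod_eq_pow_card fun ρ _ => ?_
      exact residue_eq_iff.2 (wildGroup_le_inertiaGroup hinv ρ.2 y hy)
    have h2 := residue_eq_iff.1 h1
    have h3 : ((∏ ρ : W, ⟨_, hρB ρ⟩ : B) : L) = z := by
      rw [← ValuationSubring.algebraMap_apply, map_prod]
      rfl
    rw [h3] at h2
    exact h2
  have hσzy : B.valuation (σ z - σ y ^ p ^ n) < 1 := by
    rw [← map_pow, ← map_sub, hinv]
    exact hzy
  refine valuation_sub_lt_one_of_pow p n (map_mem_of_mem hinv σ hy) hy ?_
  have e : σ y ^ p ^ n - y ^ p ^ n = (σ z - z) - (σ z - σ y ^ p ^ n) + (z - y ^ p ^ n) := by ring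
  rw [e]
  exact B.valuation.map_add_lt (B.valuation.map_sub_lt (h z hzB hzfix) hσzy) hzy

/-- If the order of the inertia group is not divisible by the residue characteristic, then some
integral element has a trace of value `1`. -/
theorem exists_valuation_sum_eq_one [FiniteDimensional K L]
    (hcard : (Nat.card (inertiaGroup hinv) : IsLocalRing.ResidueField B) ≠ 0) :
    ∃ z ∈ B, B.valuation (∑ σ : L ≃ₐ[K] L, σ z) = 1 := by
  classical
  by_contra! hcon
  set k := IsLocalRing.ResidueField B
  -- The residue characters. Two coincide exactly when they belong to the same coset of the inertia
  -- group, so the residue of the trace is |I| times the sum of the distinct characters. If it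
  -- always vanished, Dedekind independence would force |I| = 0 in k.
  let χ : (L ≃ₐ[K] L) → (B →* k) := fun σ =>
    (IsLocalRing.residue B).toMonoidHom.comp
      (((σ : L →+* L).comp B.subtype).codRestrict B.toSubring
        fun x => map_mem_of_mem hinv σ x.2).toMonoidHom
  have hχ : ∀ (σ : L ≃ₐ[K] L) (z : B),
      χ σ z = IsLocalRing.residue B ⟨σ z, map_mem_of_mem hinv σ z.2⟩ := fun _ _ => rfl
  have hχeq : ∀ σ τ : L ≃ₐ[K] L, χ σ = χ τ ↔ τ⁻¹ * σ ∈ inertiaGroup hinv := by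
    intro σ τ
    have hστ : ∀ a : L, B.valuation ((τ⁻¹ * σ) a - a) = B.valuation (σ a - τ a) := by
      intro a
      rw [← hinv τ, map_sub, AlgEquiv.mul_apply, show τ (τ⁻¹ (σ a)) = σ a from τ.apply_symm_apply _]
    constructor
    · intro h a ha
      rw [hστ]
      have := DFunLike.congr_fun h (⟨a, ha⟩ : B)
      rw [hχ, hχ] at this
      exact residue_eq_iff.1 this
    · intro h
      ext a
      rw [hχ, hχ]
      refine residue_eq_iff.2 ?_
      have := h a a.2
      rwa [hστ] at this
  have hfiber : ∀ τ : L ≃ₐ[K] L,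
      (Finset.univ.filter fun σ => χ σ = χ τ).card = Nat.card (inertiaGroup hinv) := by
    intro τ
    rw [Nat.card_eq_fintype_card, Fintype.card_subtype]
    refine Finset.card_bij (fun σ _ => τ⁻¹ * σ) ?_ ?_ ?_
    · intro σ hσ
      simpa [hχeq] using hσ
    · intro σ _ σ' _ h
      exact mul_left_cancel h
    · intro σ hσ
      exact ⟨τ * σ, by simpa [hχeq] using hσ, by simp⟩
  have hsum : ∑ f ∈ Finset.univ.image χ, (Nat.card (inertiaGroup hinv) : k) • (f : B → k) = 0 := by
    ext z
    have h1 : IsLocalRing.residue B (∑ σ : L ≃ₐ[K] L, ⟨σ z, map_mem_of_mem hinv σ z.2⟩) = 0 := by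
      have h2 : B.valuation (∑ σ : L ≃ₐ[K] L, σ z) < 1 := by
        refine lt_of_le_of_ne ((B.valuation_le_one_iff _).2 ?_) (hcon z z.2)
        exact sum_mem fun σ _ => map_mem_of_mem hinv σ z.2
      rw [IsLocalRing.residue_eq_zero_iff, ValuationSubring.valuation_lt_one_iff,
        ← ValuationSubring.algebraMap_apply, map_sum]
      exact h2
    rw [map_sum] at h1
    have h3 := Finset.sum_comp (s := Finset.univ) (fun f : B →* k => f z) χ
    rw [Finset.sum_apply, Pi.zero_apply, ← h1]
    refine Eq.trans ?_ h3.symm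
    refine Finset.sum_congr rfl fun f hf => ?_
    obtain ⟨τ, -, rfl⟩ := Finset.mem_image.1 hf
    rw [hfiber, Pi.smul_apply, smul_eq_mul, nsmul_eq_mul]
  exact hcard (linearIndependent_iff'.1 (linearIndependent_monoidHom B k) _ _ hsum (χ 1)
    (Finset.mem_image_of_mem _ (Finset.mem_univ _)))

/-- If some integral element has a trace of value `1`, then the degree of a subextension without
action on residues is not divisible by the residue characteristic. -/
theorem valuation_finrank_eq_one [FiniteDimensional K L] [IsGalois K L] {B : ValuationSubring L}
    (hinv : ∀ (σ : L ≃ₐ[K] L) (x : L), B.valuation (σ x) = B.valuation x)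
    {z : L} (hz : z ∈ B) (hz1 : B.valuation (∑ σ : L ≃ₐ[K] L, σ z) = 1)
    {E : IntermediateField K L}
    (hE : ∀ y ∈ E, y ∈ B → ∀ σ : L ≃ₐ[K] L, B.valuation (σ y - y) < 1) :
    B.valuation (Module.finrank K E : L) = 1 := by
  classical
  refine le_antisymm ((B.valuation_le_one_iff _).2 (natCast_mem B _)) ?_
  by_contra! hlt
  set H := E.fixingSubgroup
  -- The trace is taken in stages. Since w lies in E, all its conjugates are congruent to w, so the
  -- full trace is congruent to [E:K]w.
  set w : L := ∑ h : H, (h : L ≃ₐ[K] L) z with hw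
  have hwB : w ∈ B := sum_mem fun h _ => map_mem_of_mem hinv _ hz
  have hwE : w ∈ E := by
    rw [← IsGalois.fixedField_fixingSubgroup E]
    rintro ⟨g, hg⟩
    change g w = w
    rw [hw, map_sum]
    exact Fintype.sum_equiv (Equiv.mulLeft (⟨g, hg⟩ : H)) _ _ fun _ => rfl
  have hsum : ∑ σ : L ≃ₐ[K] L, σ z = ∑ q : (L ≃ₐ[K] L) ⧸ H, q.out w := by
    rw [← Finset.sum_fiberwise Finset.univ (fun σ : L ≃ₐ[K] L => (σ : (L ≃ₐ[K] L) ⧸ H))]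
    refine Finset.sum_congr rfl fun q _ => ?_
    rw [hw, map_sum]
    symm
    refine Finset.sum_bij (fun h _ => q.out * h) ?_ ?_ ?_ ?_
    · intro h _
      simp
    · intro h _ h' _ e
      exact Subtype.ext (mul_left_cancel e)
    · intro σ hσ
      rw [Finset.mem_filter] at hσ
      have h1 : q.out⁻¹ * σ ∈ H := by
        rw [← QuotientGroup.eq, QuotientGroup.out_eq', hσ.2]
      exact ⟨⟨_, h1⟩, Finset.mem_univ _, mul_inv_cancel_left _ _⟩
    · intro h _
      rfl
  have hcard : Fintype.card ((L ≃ₐ[K] L) ⧸ H) = Module.finrank K E := by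
    rw [finrank_eq_fixingSubgroup_index, Subgroup.index, Nat.card_eq_fintype_card]
  have h1 : B.valuation (∑ q : (L ≃ₐ[K] L) ⧸ H, (q.out w - w)) < 1 :=
    B.valuation.map_sum_lt' zero_lt_one fun q _ => hE w hwE hwB _
  rw [Finset.sum_sub_distrib, ← hsum, Finset.sum_const, Finset.card_univ, hcard,
    nsmul_eq_mul] at h1
  have h2 : B.valuation ((Module.finrank K E : L) * w) < 1 := by
    rw [map_mul]
    exact mul_lt_one_of_nonneg_of_lt_one_left zero_le hlt ((B.valuation_le_one_iff _).2 hwB)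
  have h3 := B.valuation.map_add_lt h1 h2
  rw [sub_add_cancel, hz1] at h3
  exact lt_irrefl _ h3

end FiniteLevel

/-! ### Degrees prime to the residue characteristic -/

section Degree

variable {K L : Type*} [Field K] [Field L] [Algebra K L]

theorem restrictNormalHom_coe (N : IntermediateField K L) [Normal K N] (σ : L ≃ₐ[K] L) (x : N) :
    ((AlgEquiv.restrictNormalHom N σ x : N) : L) = σ x :=
  AlgEquiv.restrictNormal_commutes σ N x

theorem comap_invariant [Normal K L] {B : ValuationSubring L}
    (hinv : ∀ (σ : L ≃ₐ[K] L) (x : L), B.valuation (σ x) = B.valuation x)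
    (N : IntermediateField K L) [Normal K N] (σ : N ≃ₐ[K] N) (x : N) :
    (B.comap (algebraMap N L)).valuation (σ x) = (B.comap (algebraMap N L)).valuation x := by
  obtain ⟨τ, rfl⟩ := AlgEquiv.restrictNormalHom_surjective (F := K) (K₁ := N) L σ
  rw [(comap_valuation_isEquiv B (algebraMap N L)).eq_iff]
  change B.valuation (AlgEquiv.restrictNormalHom N τ x : N) = B.valuation x
  rw [restrictNormalHom_coe, hinv]

theorem comap_valuation_natCast (B : ValuationSubring L) (N : IntermediateField K L) (n : ℕ) :
    (B.comap (algebraMap N L)).valuation (n : N) = 1 ↔ B.valuation (n : L) = 1 := by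
  rw [(comap_valuation_isEquiv B (algebraMap N L)).eq_one_iff_eq_one]
  rfl

/-- If the wild group of a finite Galois extension fixes a subextension without action on
residues, then the degree of this subextension is not divisible by the residue characteristic. -/
theorem valuation_finrank_eq_one_of_wildGroup_le [FiniteDimensional K L] [IsGalois K L]
    {B : ValuationSubring L}
    (hinv : ∀ (σ : L ≃ₐ[K] L) (x : L), B.valuation (σ x) = B.valuation x)
    {E : IntermediateField K L} (hW : wildGroup hinv ≤ E.fixingSubgroup)
    (hE : ∀ y ∈ E, y ∈ B → ∀ σ : L ≃ₐ[K] L, B.valuation (σ y - y) < 1) :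
    B.valuation (Module.finrank K E : L) = 1 := by
  obtain ⟨p, hp⟩ := CharP.exists (IsLocalRing.ResidueField B)
  rcases CharP.char_is_prime_or_zero (IsLocalRing.ResidueField B) p with hprime | rfl
  swap
  · have := CharP.charP_to_charZero (IsLocalRing.ResidueField B)
    rw [natCast_valuation_eq_one_iff]
    exact_mod_cast (Module.finrank_pos (R := K) (M := E)).ne'
  have := Fact.mk hprime
  set N := fixedField (wildGroup hinv)
  have hEN : E ≤ N := (IntermediateField.le_iff_le _ _).2 hW
  have hinvN := comap_invariant hinv N
  have hequiv := comap_valuation_isEquiv B (algebraMap N L)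
  set BN := B.comap (algebraMap N L)
  -- An inertia element of order p over N would lift to τ in the inertia group of L with τ^p wild.
  -- Then τ is wild itself and acts trivially on N.
  have hcard : (Nat.card (inertiaGroup hinvN) : IsLocalRing.ResidueField BN) ≠ 0 := by
    rw [← natCast_valuation_eq_one_iff, comap_valuation_natCast, natCast_valuation_eq_one_iff,
      ne_eq, CharP.cast_eq_zero_iff _ p]
    intro hdvd
    obtain ⟨σ, hσ⟩ := exists_prime_orderOf_dvd_card' p hdvd
    obtain ⟨τ, hτ⟩ := AlgEquiv.restrictNormalHom_surjective (F := K) (K₁ := N) L (σ : N ≃ₐ[K] N)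
    have hτN : ∀ x : N, τ x = ((σ : N ≃ₐ[K] N) x : N) := fun x => by
      rw [← hτ, restrictNormalHom_coe]
    have hτI : τ ∈ inertiaGroup hinv := by
      refine mem_inertiaGroup_of_forall_fixed (p := p) hinv fun z hz hzW => ?_
      have hzN : z ∈ N := fun ρ => hzW ρ ρ.2
      have h1 := hequiv.lt_one_iff_lt_one.1 (σ.2 ⟨z, hzN⟩ hz)
      rw [hτN ⟨z, hzN⟩]
      exact h1
    have hτp : τ ^ p ∈ wildGroup hinv := by
      rw [← fixingSubgroup_fixedField (wildGroup hinv)]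
      have h1 : AlgEquiv.restrictNormalHom N (τ ^ p) = 1 := by
        rw [map_pow, hτ, ← hσ]
        exact_mod_cast congrArg Subtype.val (pow_orderOf_eq_one σ)
      intro x
      change (τ ^ p) x = x
      rw [← restrictNormalHom_coe N, h1]
      rfl
    have hτW := mem_wildGroup_of_pow_mem hinv hτI hτp
    have hσ1 : σ = 1 := by
      refine Subtype.ext (AlgEquiv.ext fun x => Subtype.ext ?_)
      rw [← hτN]
      exact x.2 ⟨τ, hτW⟩
    rw [hσ1, orderOf_one] at hσ
    exact hprime.one_lt.ne hσ
  obtain ⟨z, hz, hz1⟩ := exists_valuation_sum_eq_one hinvN hcard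
  have h1 := valuation_finrank_eq_one hinvN hz hz1 (E := restrict hEN) fun y hy hyB σ => by
    obtain ⟨τ, rfl⟩ := AlgEquiv.restrictNormalHom_surjective (F := K) (K₁ := N) L σ
    rw [hequiv.lt_one_iff_lt_one]
    have h2 := hE y ((mem_restrict hEN y).1 hy) hyB τ
    rw [← restrictNormalHom_coe] at h2
    exact h2
  rw [comap_valuation_natCast] at h1
  rwa [(restrictAlgEquiv hEN).toLinearEquiv.finrank_eq]

/-- The condition depends only on the coset of `σ` modulo the open subgroup fixing `a`. -/
theorem isClosed_setOf_apply [IsGalois K L] (a : L) (P : L → Prop) :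
    IsClosed {σ : L ≃ₐ[K] L | P (σ a)} := by
  rw [← isOpen_compl_iff, isOpen_iff_forall_mem_open]
  intro σ hσ
  have hfin : FiniteDimensional K K⟮a⟯ := adjoin.finiteDimensional (Algebra.IsIntegral.isIntegral a)
  refine ⟨(σ * ·) '' (K⟮a⟯.fixingSubgroup : Set (L ≃ₐ[K] L)), ?_,
    isOpenMap_mul_left σ _ (fixingSubgroup_isOpen K⟮a⟯), ⟨1, one_mem _, mul_one σ⟩⟩
  rintro _ ⟨τ, hτ, rfl⟩
  have : τ a = a := hτ ⟨a, mem_adjoin_simple_self K a⟩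
  change ¬ P ((σ * τ) a)
  rw [AlgEquiv.mul_apply, this]
  exact hσ

/-- If the wild group of a Galois extension is trivial, then the degree of a finite subextension
without action on residues is not divisible by the residue characteristic. -/
theorem valuation_finrank_eq_one_of_wildGroup_eq_bot [IsGalois K L] {B : ValuationSubring L}
    (hinv : ∀ (σ : L ≃ₐ[K] L) (x : L), B.valuation (σ x) = B.valuation x)
    (hW : wildGroup hinv = ⊥) {E : IntermediateField K L} [FiniteDimensional K E]
    (hE : ∀ y ∈ E, y ∈ B → ∀ σ : L ≃ₐ[K] L, B.valuation (σ y - y) < 1) :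
    B.valuation (Module.finrank K E : L) = 1 := by
  classical
  -- By compactness, finitely many of the conditions defining the wild group already force an
  -- automorphism to fix E. They hold for wild automorphisms of a finite Galois M containing E and
  -- the elements involved, so the finite case applies to M.
  have hcomp : IsCompact (E.fixingSubgroup : Set (L ≃ₐ[K] L))ᶜ :=
    (fixingSubgroup_isOpen E).isClosed_compl.isCompact
  obtain ⟨s, hs⟩ := hcomp.elim_finite_subfamily_closed
    (fun a : L => {σ : L ≃ₐ[K] L | a ≠ 0 → B.valuation (σ a - a) < B.valuation a})
    (fun a => isClosed_setOf_apply a fun b => a ≠ 0 → B.valuation (b - a) < B.valuation a)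
    (by
      rw [← Set.disjoint_iff_inter_eq_empty, Set.disjoint_compl_left_iff_subset]
      intro σ hσ
      have h1 : σ ∈ wildGroup hinv := fun a ha => Set.mem_iInter.1 hσ a ha
      rw [hW, Subgroup.mem_bot] at h1
      rw [h1]
      exact one_mem _)
  have hs' : ∀ σ : L ≃ₐ[K] L, (∀ a ∈ s, a ≠ 0 → B.valuation (σ a - a) < B.valuation a) →
      σ ∈ E.fixingSubgroup := by
    intro σ hσ
    by_contra hcon
    have : σ ∈ (∅ : Set (L ≃ₐ[K] L)) := by
      rw [← hs]
      exact ⟨hcon, Set.mem_iInter₂.2 hσ⟩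
    exact this
  obtain ⟨α, hα⟩ := Field.exists_primitive_element K E
  let M := FiniteGaloisIntermediateField.adjoin K ((insert (α : L) s : Finset L) : Set L)
  have hsub : ∀ x ∈ insert (α : L) s, x ∈ M.toIntermediateField := fun x hx =>
    FiniteGaloisIntermediateField.subset_adjoin K _ (Finset.mem_coe.2 hx)
  have hEM : E ≤ M.toIntermediateField := by
    intro y hy
    have h1 : (⟨y, hy⟩ : E) ∈ K⟮α⟯ := by rw [hα]; exact mem_top
    obtain ⟨g, -, hg⟩ := exists_eq_aeval_of_mem_adjoin (Algebra.IsIntegral.isIntegral α) h1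
    have h2 : y = aeval (α : L) g := by
      have := congrArg (algebraMap E L) hg
      rwa [← aeval_algebraMap_apply] at this
    rw [h2, aeval_eq_sum_range]
    exact sum_mem fun i _ =>
      M.toIntermediateField.smul_mem (pow_mem (hsub _ (Finset.mem_insert_self _ _)) i)
  have hinvM := comap_invariant hinv M.toIntermediateField
  have hequiv := comap_valuation_isEquiv B (algebraMap M.toIntermediateField L)
  have h1 := valuation_finrank_eq_one_of_wildGroup_le hinvM (E := restrict hEM)
    (by
      intro σ hσ
      obtain ⟨τ, rfl⟩ := AlgEquiv.restrictNormalHom_surjective (F := K) (K₁ := M) L σ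
      have hτ := hs' τ fun a ha ha0 => by
        have haM := hsub a (Finset.mem_insert_of_mem ha)
        have h2 := hequiv.lt_iff_lt.1 (hσ ⟨a, haM⟩ (by simpa [Subtype.ext_iff] using ha0))
        have h3 := restrictNormalHom_coe M.toIntermediateField τ ⟨a, haM⟩
        change B.valuation (_ - a) < B.valuation a at h2
        rwa [← h3]
      rintro ⟨x, hx⟩
      apply Subtype.ext
      have h3 := restrictNormalHom_coe M.toIntermediateField τ x
      exact h3.trans (hτ ⟨x, (mem_restrict hEM x).1 hx⟩))
    fun y hy hyB σ => by
      obtain ⟨τ, rfl⟩ := AlgEquiv.restrictNormalHom_surjective (F := K) (K₁ := M) L σ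
      rw [hequiv.lt_one_iff_lt_one]
      have h2 := hE y ((mem_restrict hEM y).1 hy) hyB τ
      rw [← restrictNormalHom_coe M.toIntermediateField] at h2
      exact h2
  rw [comap_valuation_natCast] at h1
  rwa [(restrictAlgEquiv hEM).toLinearEquiv.finrank_eq]

end Degree

/-! ### Separably tame fields have no proper immediate separable extension -/

section SeparablyTame

-- Galois invariance puts every automorphism into the decomposition group, so wild automorphisms lie
-- in the ramification group, which fixes everything.
open scoped Pointwise in
theorem wildGroup_eq_bot_of_absoluteRamificationField_eq_top {K : Type*} [Field K]
    {B : ValuationSubring (SeparableClosure K)}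
    (hinv : ∀ (σ : SeparableClosure K ≃ₐ[K] SeparableClosure K) (x : SeparableClosure K),
      B.valuation (σ x) = B.valuation x)
    (htop : absoluteRamificationField K B = ⊤) : wildGroup hinv = ⊥ := by
  rw [eq_bot_iff]
  intro σ hσ
  have hσB : σ ∈ B.decompositionSubgroup K := by
    rw [ValuationSubring.decompositionSubgroup, MulAction.mem_stabilizer_iff]
    ext x
    rw [ValuationSubring.mem_pointwise_smul_iff_inv_smul_mem, ← B.valuation_le_one_iff,
      ← B.valuation_le_one_iff, AlgEquiv.smul_def, hinv]
  have hσr : σ ∈ ramificationGroup K B := by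
    refine ⟨⟨⟨σ, hσB⟩, ?_, rfl⟩, fun a ha => ?_⟩
    · change _ ∈ MonoidHom.ker _
      rw [MonoidHom.mem_ker]
      ext r
      obtain ⟨y, rfl⟩ := IsLocalRing.residue_surjective r
      change (⟨σ, hσB⟩ : B.decompositionSubgroup K) • IsLocalRing.residue B y =
        IsLocalRing.residue B y
      rw [← IsLocalRing.ResidueField.residue_smul]
      exact residue_eq_iff.2 (wildGroup_le_inertiaGroup hinv hσ y y.2)
    · rw [show σ a / a - 1 = (σ a - a) / a by rw [sub_div, div_self ha], map_div₀,
        div_lt_one₀ (B.valuation.pos_iff.2 ha)]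
      exact hσ a ha
  refine AlgEquiv.ext fun a => ?_
  have ha : a ∈ absoluteRamificationField K B := by rw [htop]; exact mem_top
  exact ha ⟨σ, hσr⟩

variable {K L : Type*} [Field K] [Field L] [Algebra K L]

/-- The trace is an integer multiple of a sum of conjugates, all of the same value. -/
theorem valuation_trace_le [Normal K L] {B : ValuationSubring L}
    (hinv : ∀ (σ : L ≃ₐ[K] L) (x : L), B.valuation (σ x) = B.valuation x)
    {E : IntermediateField K L} [FiniteDimensional K E] (x : E) :
    B.valuation (algebraMap K L (Algebra.trace K E x)) ≤ B.valuation (x : L) := by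
  have hmin : minpoly K (x : L) = minpoly K x := (minpoly_eq x).symm
  rw [trace_eq_sum_roots (F := L) (by rw [← hmin]; exact Normal.splits ‹_› _), nsmul_eq_mul,
    map_mul]
  have h1 : ∀ s : Multiset L, (∀ y ∈ s, B.valuation y ≤ B.valuation (x : L)) →
      B.valuation s.sum ≤ B.valuation (x : L) := by
    intro s
    induction s using Multiset.induction_on with
    | empty => simp
    | cons y s ih =>
      intro hs
      rw [Multiset.sum_cons]
      exact B.valuation.map_add_le (hs y (Multiset.mem_cons_self y s))
        (ih fun z hz => hs z (Multiset.mem_cons_of_mem hz))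
  refine mul_le_of_le_one_of_le ((B.valuation_le_one_iff _).2 (natCast_mem B _)) (h1 _ ?_)
  intro y hy
  rw [← hmin] at hy
  obtain ⟨σ, rfl⟩ := minpoly.exists_algEquiv_of_root'
    (Algebra.IsAlgebraic.isAlgebraic (x : L)) ((mem_aroots.1 hy).2)
  exact (hinv σ x).le

/-- If the wild group of a Galois extension is trivial, then there are no proper immediate
subextensions. -/
theorem mem_range_of_wildGroup_eq_bot [IsGalois K L] {B : ValuationSubring L}
    (hinv : ∀ (σ : L ≃ₐ[K] L) (x : L), B.valuation (σ x) = B.valuation x)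
    (hW : wildGroup hinv = ⊥) {E : IntermediateField K L} [FiniteDimensional K E]
    (hE : ∀ y ∈ E, y ≠ 0 → ∃ c : K, B.valuation (algebraMap K L c - y) < B.valuation y)
    (a : E) : (a : L) ∈ (algebraMap K L).range := by
  have hn := valuation_finrank_eq_one_of_wildGroup_eq_bot hinv hW (E := E) fun y hy hyB σ => by
    rcases eq_or_ne y 0 with rfl | hy0
    · simp
    obtain ⟨c, hc⟩ := hE y hy hy0
    have h1 : B.valuation (σ (algebraMap K L c - y)) < B.valuation y := by rwa [hinv]
    have h2 := B.valuation.map_sub_lt hc h1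
    rw [map_sub σ, σ.commutes, sub_sub_sub_cancel_left] at h2
    exact h2.trans_le ((B.valuation_le_one_iff _).2 hyB)
  set n := Module.finrank K E
  have hn0 : (n : K) ≠ 0 := by
    intro h
    rw [← map_natCast (algebraMap K L), h, map_zero, map_zero] at hn
    exact zero_ne_one hn
  -- The element a − s has trace 0. If it is nonzero and c in K approximates it, then c − (a − s)
  -- has trace nc, of value v(c) = v(a − s), although its own value is smaller.
  set s := Algebra.trace K E a / n with hs
  refine ⟨s, ?_⟩
  by_contra hne
  have hb0 : ((a - algebraMap K E s : E) : L) ≠ 0 := by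
    intro h
    rw [AddSubgroupClass.coe_sub, sub_eq_zero] at h
    exact hne h.symm
  obtain ⟨c, hc⟩ := hE _ (a - algebraMap K E s).2 hb0
  have htr : Algebra.trace K E (algebraMap K E c - (a - algebraMap K E s)) = n * c := by
    rw [map_sub, map_sub, Algebra.trace_algebraMap, Algebra.trace_algebraMap, nsmul_eq_mul,
      nsmul_eq_mul, hs, mul_div_cancel₀ _ hn0, sub_self, sub_zero]
  have h1 := valuation_trace_le hinv (algebraMap K E c - (a - algebraMap K E s))
  rw [htr, map_mul, map_mul, map_natCast, hn, one_mul, eq_of_sub_lt _ hc] at h1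
  exact (h1.trans_lt hc).false

end SeparablyTame

/-- It suffices to treat the finite extension K(x) for each x in L, embedded in K^sep:
approximability from K passes to subextensions. -/
theorem IsSeparablyTame.isSeparableAlgebraicallyMaximal {K : Type u} [Field K]
    {A : ValuationSubring K} (hA : IsSeparablyTame A) : IsSeparableAlgebraicallyMaximal A := by
  intro L _ _ _ C hC x
  let f : L →ₐ[K] SeparableClosure K := IsSepClosed.lift
  let := f.toRingHom.toAlgebra
  obtain ⟨B, hB⟩ := exists_extension (L := SeparableClosure K) C
  have hequiv := comap_valuation_isEquiv B (algebraMap L (SeparableClosure K))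
  rw [hB] at hequiv
  have hBA : B.comap (algebraMap K (SeparableClosure K)) = A := by
    rw [← hC.comap_eq, ← hB, ValuationSubring.comap_comap]
    congr 1
    exact f.comp_algebraMap.symm
  have hinv : ∀ (σ : SeparableClosure K ≃ₐ[K] SeparableClosure K) (x : SeparableClosure K),
      B.valuation (σ x) = B.valuation x :=
    IsHenselian.valuation_algEquiv_apply (by rw [hBA]; exact hA.1)
  have hW := wildGroup_eq_bot_of_absoluteRamificationField_eq_top hinv (hA.2 B hBA)
  have : FiniteDimensional K K⟮f x⟯ :=
    adjoin.finiteDimensional (Algebra.IsIntegral.isIntegral (f x))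
  have hle : K⟮f x⟯ ≤ f.fieldRange := adjoin_simple_le_iff.2 ⟨x, rfl⟩
  obtain ⟨c, hc⟩ := mem_range_of_wildGroup_eq_bot hinv hW (E := K⟮f x⟯) (by
    intro y hy hy0
    obtain ⟨z, rfl⟩ := hle hy
    obtain ⟨c, hc⟩ := hC.exists_sub_lt (y := z) (by rintro rfl; exact hy0 (map_zero f))
    refine ⟨c, ?_⟩
    have h1 := hequiv.lt_iff_lt.1 hc
    change B.valuation (f (algebraMap K L c - z)) < B.valuation (f z) at h1
    rwa [map_sub, f.commutes] at h1) ⟨f x, mem_adjoin_simple_self K _⟩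
  exact ⟨c, f.injective ((f.commutes c).trans hc)⟩

/-! ### Approximate p-th roots; divisibility and perfectness -/

section ApproximateRoots

variable {K L : Type*} [Field K] [Field L] [Algebra K L]

/-- An element of a separably closed field has approximate `p`-th roots, also if `p` is the
characteristic. -/
theorem exists_pow_sub_lt [IsSepClosed L] (B : ValuationSubring L) {p : ℕ} (hp : p.Prime) {π : K}
    (hπ0 : π ≠ 0) (hπ : B.valuation (algebraMap K L π) < 1) {d : K} (hd0 : d ≠ 0)
    (hd : B.valuation (algebraMap K L d) ≤ 1) :
    ∃ b : L, B.valuation (b ^ p - algebraMap K L d) < B.valuation (algebraMap K L d) ∧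
      (minpoly K b).natDegree ≤ p := by
  have hdL : algebraMap K L d ≠ 0 := (_root_.map_ne_zero _).2 hd0
  have hvd : 0 < B.valuation (algebraMap K L d) := B.valuation.pos_iff.2 hdL
  by_cases hpL : (p : L) = 0
  · have hdπ : algebraMap K L (d * π) ≠ 0 := (_root_.map_ne_zero _).2 (mul_ne_zero hd0 hπ0)
    -- When p = 0 in L, X^p − d is inseparable and is replaced by X^p + dπX − d. Its root b is
    -- integral, so the error dπb is smaller than d.
    obtain ⟨b, hb⟩ := IsSepClosed.exists_root_C_mul_X_pow_add_C_mul_X_add_C 1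
      (algebraMap K L (d * π)) (-algebraMap K L d) hpL hp.two_le hdπ
    rw [one_mul] at hb
    have hvb : B.valuation b ≤ 1 := by
      by_contra! hlt
      have h1 : b ^ p = algebraMap K L d - algebraMap K L (d * π) * b := by linear_combination hb
      have h2 : B.valuation (b ^ p) ≤ B.valuation b := by
        rw [h1]
        refine B.valuation.map_sub_le (hd.trans hlt.le) ?_
        rw [map_mul, map_mul, map_mul]
        exact mul_le_of_le_one_left' (mul_le_one' hd hπ.le)
      rw [map_pow] at h2
      exact (h2.trans_lt (lt_self_pow₀ hlt hp.one_lt)).false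
    refine ⟨b, ?_, ?_⟩
    · rw [show b ^ p - algebraMap K L d = -(algebraMap K L d * (algebraMap K L π * b)) by
        rw [map_mul] at hb; linear_combination hb, Valuation.map_neg, map_mul, map_mul]
      exact mul_lt_of_lt_one_right hvd (mul_lt_one_of_lt_of_le hπ hvb)
    · have hq : (C (d * π) * X + C (-d)).degree < (p : WithBot ℕ) :=
        degree_linear_le.trans_lt (by exact_mod_cast hp.one_lt)
      have hq' : (X ^ p + (C (d * π) * X + C (-d))).natDegree ≤ p := by
        rw [natDegree_add_eq_left_of_degree_lt (by rwa [degree_X_pow]), natDegree_X_pow]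
      refine (natDegree_le_of_dvd (minpoly.dvd K b ?_) (monic_X_pow_add hq).ne_zero).trans hq'
      simp only [map_add, map_mul, map_pow, aeval_X, aeval_C, map_neg] at hb ⊢
      linear_combination hb
  · have : NeZero (p : L) := ⟨hpL⟩
    obtain ⟨b, hb⟩ := IsSepClosed.exists_pow_nat_eq (algebraMap K L d) p
    refine ⟨b, by rw [hb, sub_self, map_zero]; exact hvd, ?_⟩
    refine (natDegree_le_of_dvd (minpoly.dvd K b (p := X ^ p - C d) ?_)
      (X_pow_sub_C_ne_zero hp.pos d)).trans natDegree_X_pow_sub_C.le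
    simp [hb]

/-- If the wild group of a Galois extension is trivial, then there are no elements of degree `p`
generating a defectless extension that is purely wild. -/
theorem exists_sum_lt_of_wildGroup_eq_bot [IsGalois K L] {B : ValuationSubring L}
    (hinv : ∀ (σ : L ≃ₐ[K] L) (x : L), B.valuation (σ x) = B.valuation x)
    (hW : wildGroup hinv = ⊥) {p : ℕ} [hp : Fact p.Prime] [CharP (IsLocalRing.ResidueField B) p]
    {b : L} {d : K} (hb : B.valuation (b ^ p - algebraMap K L d) < B.valuation (algebraMap K L d))
    (hdeg : (minpoly K b).natDegree ≤ p) :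
    ∃ c : ℕ → K, ∃ j < p, B.valuation (∑ i ∈ Finset.range p, algebraMap K L (c i) * b ^ i) <
      B.valuation (algebraMap K L (c j) * b ^ j) := by
  -- Otherwise no sum of terms c_i b^i with i < p has value below that of one of its terms. This
  -- forces b to have degree exactly p, and, since σb/b is congruent to 1, the Galois group acts
  -- trivially on the residues of K(b). Then p would be a unit.
  by_contra! hcon
  have hvb := eq_of_sub_lt _ hb
  have hvd : 0 < B.valuation (algebraMap K L d) := zero_le.trans_lt hb
  have hb0 : b ≠ 0 := by
    rintro rfl
    rw [zero_pow hp.out.ne_zero, map_zero] at hvb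
    exact hvd.ne hvb
  have hsum : ∀ g : K[X], g.natDegree < p →
      aeval b g = ∑ i ∈ Finset.range p, algebraMap K L (g.coeff i) * b ^ i := fun g hg => by
    simp only [aeval_eq_sum_range' hg, Algebra.smul_def]
  have hint : IsIntegral K b := Algebra.IsIntegral.isIntegral b
  have hdeg' : (minpoly K b).natDegree = p := by
    refine hdeg.eq_of_not_lt fun hlt => ?_
    have h1 := hcon (minpoly K b).coeff _ hlt
    rw [← hsum _ hlt, minpoly.aeval, map_zero, coeff_natDegree, (minpoly.monic hint).leadingCoeff,
      map_one, one_mul, le_zero_iff, map_eq_zero] at h1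
    exact pow_ne_zero _ hb0 h1
  have hσb : ∀ σ : L ≃ₐ[K] L, B.valuation (σ b - b) < B.valuation b := by
    intro σ
    have h1 : B.valuation (σ (b ^ p - algebraMap K L d)) < B.valuation (algebraMap K L d) := by
      rwa [hinv]
    have h2 := B.valuation.map_sub_lt h1 hb
    rw [map_sub σ, σ.commutes, sub_sub_sub_cancel_right, ← hvb, map_pow] at h2
    have hb1 : B.valuation (σ b / b) = 1 := by
      rw [map_div₀, hinv, div_self (B.valuation.ne_zero_iff.2 hb0)]
    have h3 := valuation_sub_lt_one_of_pow (B := B) p 1 ((B.valuation_le_one_iff _).1 hb1.le)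
      (one_mem B) (by
        rw [one_pow, pow_one, div_pow, div_sub_one (pow_ne_zero p hb0), map_div₀,
          div_lt_one₀ (B.valuation.pos_iff.2 (pow_ne_zero p hb0))]
        exact h2)
    rwa [div_sub_one hb0, map_div₀, div_lt_one₀ (B.valuation.pos_iff.2 hb0)] at h3
  have hσpow : ∀ (σ : L ≃ₐ[K] L) (i : ℕ), B.valuation (σ b ^ i - b ^ i) < B.valuation (b ^ i) := by
    intro σ i
    induction i with
    | zero => simp
    | succ i ih =>
      rw [pow_succ, pow_succ]
      exact sub_lt_mul _ ih (hσb σ)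
  have : FiniteDimensional K K⟮b⟯ := adjoin.finiteDimensional hint
  have hn := valuation_finrank_eq_one_of_wildGroup_eq_bot hinv hW (E := K⟮b⟯) fun y hy hyB σ => by
    obtain ⟨g, hg, rfl⟩ := exists_eq_aeval_of_mem_adjoin hint hy
    rw [hdeg'] at hg
    have hyv := (B.valuation_le_one_iff _).2 hyB
    rw [hsum g hg] at hyv ⊢
    rw [map_sum, ← Finset.sum_sub_distrib]
    refine B.valuation.map_sum_lt' zero_lt_one fun i hi => ?_
    rw [map_mul, σ.commutes, map_pow, ← mul_sub, map_mul]
    rcases eq_or_ne (g.coeff i) 0 with h0 | h0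
    · simp [h0]
    · have h1 := (hcon g.coeff i (Finset.mem_range.1 hi)).trans hyv
      rw [map_mul] at h1
      refine (mul_lt_mul_of_pos_left (hσpow σ i) (B.valuation.pos_iff.2 ?_)).trans_le h1
      exact (_root_.map_ne_zero _).2 h0
  rw [adjoin.finrank hint, hdeg', natCast_valuation_eq_one_iff] at hn
  exact hn (CharP.cast_eq_zero _ p)

/-- When the nonzero terms have distinct values, the largest one is the value of the sum. -/
theorem valuation_le_valuation_sum {Γ ι : Type*} [LinearOrderedCommGroupWithZero Γ]
    (v : Valuation L Γ) {s : Finset ι} {f : ι → L}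
    (h : ∀ i ∈ s, ∀ j ∈ s, f i ≠ 0 → v (f i) = v (f j) → i = j) {j : ι} (hj : j ∈ s) :
    v (f j) ≤ v (∑ i ∈ s, f i) := by
  classical
  obtain ⟨k, hk, hmax⟩ := s.exists_max_image (fun i => v (f i)) ⟨j, hj⟩
  rcases eq_or_ne (f k) 0 with h0 | h0
  · have := hmax j hj
    rw [h0, map_zero] at this
    exact this.trans zero_le
  · rw [v.map_sum_eq_of_lt hk]
    · exact hmax j hj
    · intro i hi
      rw [Finset.mem_sdiff, Finset.mem_singleton] at hi
      exact (hmax i hi.1).lt_of_ne fun e => hi.2 (h k hk i hi.1 h0 e.symm).symm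

/-- If the wild group of a separably closed Galois extension is trivial, then the value group is
divisible by the residue characteristic. -/
theorem exists_valuation_pow_eq_of_wildGroup_eq_bot [IsGalois K L] [IsSepClosed L]
    {B : ValuationSubring L}
    (hinv : ∀ (σ : L ≃ₐ[K] L) (x : L), B.valuation (σ x) = B.valuation x)
    (hW : wildGroup hinv = ⊥) {p : ℕ} [hp : Fact p.Prime] [CharP (IsLocalRing.ResidueField B) p]
    {π : K} (hπ0 : π ≠ 0) (hπ : B.valuation (algebraMap K L π) < 1) {d : K} (hd0 : d ≠ 0) :
    ∃ e : K, B.valuation (algebraMap K L e) ^ p = B.valuation (algebraMap K L d) := by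
  wlog hd : B.valuation (algebraMap K L d) ≤ 1 generalizing d
  · obtain ⟨e, he⟩ := this (inv_ne_zero hd0) (by
      rw [map_inv₀, map_inv₀]
      exact inv_le_one_of_one_le₀ (not_le.1 hd).le)
    refine ⟨e⁻¹, ?_⟩
    rw [map_inv₀, map_inv₀, inv_pow, he, map_inv₀, map_inv₀, inv_inv]
  obtain ⟨b, hb, hdeg⟩ := exists_pow_sub_lt B hp.out hπ0 hπ hd0 hd
  obtain ⟨c, j, hj, hlt⟩ := exists_sum_lt_of_wildGroup_eq_bot hinv hW hb hdeg
  have hvb := eq_of_sub_lt _ hb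
  have hvd : B.valuation (algebraMap K L d) ≠ 0 := (zero_le.trans_lt hb).ne'
  rw [map_pow] at hvb
  by_contra! hcon
  -- Raising to the inverse u of m modulo p and using v(b)^p = v(d) would make v(b) a value of K,
  -- hence v(d) a p-th power.
  have key : ∀ (k : K) (m : ℕ), 0 < m → m < p →
      B.valuation b ^ m ≠ B.valuation (algebraMap K L k) := by
    intro k m hm0 hmp h
    obtain ⟨u, -, hu⟩ := Nat.exists_mul_mod_eq_one_of_coprime
      (Nat.coprime_of_lt_prime hm0.ne' hmp hp.out).symm hp.out.one_lt
    have h1 := Nat.div_add_mod (m * u) p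
    rw [hu] at h1
    have h2 : B.valuation (algebraMap K L k) ^ u
        = B.valuation (algebraMap K L d) ^ (m * u / p) * B.valuation b := by
      rw [← h, ← pow_mul, ← h1, pow_succ, pow_mul, hvb, h1]
    refine hcon (k ^ u / d ^ (m * u / p)) ?_
    rw [← hvb]
    congr 1
    simp only [map_div₀, map_pow]
    rw [h2, mul_div_cancel_left₀ _ (pow_ne_zero _ hvd)]
  have hb0 : B.valuation b ≠ 0 := by
    intro h0
    rw [h0, zero_pow hp.out.ne_zero] at hvb
    exact hvd hvb.symm
  have key' : ∀ i j, i < j → j < p → algebraMap K L (c i) * b ^ i ≠ 0 →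
      B.valuation (algebraMap K L (c i) * b ^ i) ≠ B.valuation (algebraMap K L (c j) * b ^ j) := by
    intro i j hij hjp h0 h
    refine key (c i / c j) (j - i) (by omega) (by omega) ?_
    have hcj : B.valuation (algebraMap K L (c j)) ≠ 0 := by
      intro hc
      rw [map_mul _ _ (b ^ j), hc, zero_mul, map_eq_zero] at h
      exact h0 h
    obtain ⟨m, rfl⟩ := Nat.exists_eq_add_of_lt hij
    rw [map_mul, map_mul, map_pow, map_pow, add_assoc, pow_add, mul_left_comm, mul_comm] at h
    have h1 := mul_left_cancel₀ (pow_ne_zero i hb0) h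
    rw [add_assoc] at hcj ⊢
    rw [map_div₀, map_div₀, h1, mul_div_cancel_left₀ _ hcj, Nat.add_sub_cancel_left]
  refine hlt.not_ge (valuation_le_valuation_sum B.valuation
    (f := fun i => algebraMap K L (c i) * b ^ i) ?_ (Finset.mem_range.2 hj))
  intro i hi j hj h0 h
  rw [Finset.mem_range] at hi hj
  rcases lt_trichotomy i j with hij | hij | hij
  · exact absurd h (key' i j hij hj h0)
  · exact hij
  · refine absurd h.symm (key' j i hij hi ?_)
    rw [← B.valuation.ne_zero_iff, ← h]
    exact B.valuation.ne_zero_iff.2 h0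

/-- If the wild group of a separably closed Galois extension is trivial, then the residue field is
closed under roots of exponent equal to the residue characteristic. -/
theorem exists_residue_pow_eq_of_wildGroup_eq_bot [IsGalois K L] [IsSepClosed L]
    {A : ValuationSubring K} {B : ValuationSubring L} (hA : B.comap (algebraMap K L) = A)
    (hinv : ∀ (σ : L ≃ₐ[K] L) (x : L), B.valuation (σ x) = B.valuation x)
    (hW : wildGroup hinv = ⊥) {p : ℕ} [hp : Fact p.Prime] [CharP (IsLocalRing.ResidueField B) p]
    {π : K} (hπ0 : π ≠ 0) (hπ : B.valuation (algebraMap K L π) < 1)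
    (δ : IsLocalRing.ResidueField A) : ∃ ε, ε ^ p = δ := by
  obtain ⟨ψ, hψ⟩ := exists_residueField_ringHom hA
  have hequiv := comap_valuation_isEquiv B (algebraMap K L)
  rw [hA] at hequiv
  by_contra! hcon
  have hirr := X_pow_sub_C_irreducible_of_prime hp.out hcon
  obtain ⟨d, rfl⟩ := IsLocalRing.residue_surjective δ
  have hd1 : B.valuation (algebraMap K L d) = 1 := by
    refine hequiv.eq_one_iff_eq_one.1 ((ValuationSubring.valuation_eq_one_iff _ _).1 ?_)
    rw [← IsLocalRing.residue_ne_zero_iff_isUnit]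
    intro h0
    exact hcon 0 (by rw [h0, zero_pow hp.out.ne_zero])
  have hd0 : (d : K) ≠ 0 := by
    intro h0
    rw [h0, map_zero, map_zero] at hd1
    exact zero_ne_one hd1
  obtain ⟨b, hb, hdeg⟩ := exists_pow_sub_lt B hp.out hπ0 hπ hd0 hd1.le
  obtain ⟨c, j, hj, hlt⟩ := exists_sum_lt_of_wildGroup_eq_bot hinv hW hb hdeg
  have hvb := eq_of_sub_lt _ hb
  rw [hd1, map_pow, pow_eq_one_iff_of_nonneg zero_le hp.out.ne_zero] at hvb
  have hbB : b ∈ B := (B.valuation_le_one_iff _).1 hvb.le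
  let := ψ.toAlgebra
  set β := IsLocalRing.residue B ⟨b, hbB⟩
  have hroot : aeval β (X ^ p - C (IsLocalRing.residue A d)) = 0 := by
    obtain ⟨c, hc, hc'⟩ := hψ (X ^ p - C d) ⟨b, hbB⟩
    rw [Polynomial.map_sub, Polynomial.map_pow, map_X, map_C] at hc hc'
    refine hc'.symm.trans ?_
    rw [IsLocalRing.residue_eq_zero_iff, ValuationSubring.valuation_lt_one_iff, hc, map_sub,
      map_pow, aeval_X, aeval_C]
    exact hb.trans_le hd1.le
  -- Thus the residue β of b has degree p, and no nonzero polynomial of degree below p over the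
  -- residue field of K vanishes at it.
  have hmin := minpoly.eq_of_irreducible_of_monic hirr hroot (monic_X_pow_sub_C _ hp.out.ne_zero)
  -- Dividing by a coefficient of largest value gives an integral polynomial G with nonzero
  -- reduction. So G(b) is a unit, and the sum has the value of its largest term.
  obtain ⟨k, hk, hmax⟩ := (Finset.range p).exists_max_image
    (fun i => B.valuation (algebraMap K L (c i))) ⟨j, Finset.mem_range.2 hj⟩
  have hck : c k ≠ 0 := by
    intro h0
    have h1 := hmax j (Finset.mem_range.2 hj)
    rw [h0, map_zero, map_zero, le_zero_iff] at h1
    rw [map_mul, h1, zero_mul] at hlt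
    exact not_lt_zero hlt
  have hvk : 0 < B.valuation (algebraMap K L (c k)) :=
    B.valuation.pos_iff.2 ((_root_.map_ne_zero _).2 hck)
  have hmem : ∀ i, i < p → c i / c k ∈ A := by
    intro i hi
    rw [← hA, ValuationSubring.mem_comap, ← B.valuation_le_one_iff, map_div₀, map_div₀,
      div_le_one₀ hvk]
    exact hmax i (Finset.mem_range.2 hi)
  let a : ℕ → A := fun i => if h : i < p then ⟨c i / c k, hmem i h⟩ else 0
  have ha : ∀ i, i < p → (a i : K) = c i / c k := fun i hi => by simp [a, hi]
  set G : A[X] := ∑ i ∈ Finset.range p, C (a i) * X ^ i with hG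
  have hcoeff : G.coeff k = 1 := by
    rw [hG, finsetSum_coeff]
    simp only [coeff_C_mul, coeff_X_pow, mul_ite, mul_one, mul_zero]
    rw [Finset.sum_ite_eq, if_pos hk]
    exact Subtype.ext ((ha k (Finset.mem_range.1 hk)).trans (div_self hck))
  have hGdeg : G.degree < p := by
    refine (degree_sum_le _ _).trans_lt
      ((Finset.sup_lt_iff (WithBot.bot_lt_coe p)).2 fun i hi => ?_)
    exact (degree_C_mul_X_pow_le _ _).trans_lt (Nat.cast_lt.2 (Finset.mem_range.1 hi))
  have hG0 : G.map (IsLocalRing.residue A) ≠ 0 := by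
    intro h0
    have h1 := congrArg (coeff · k) h0
    simp only [coeff_map, hcoeff, map_one, coeff_zero] at h1
    exact one_ne_zero h1
  obtain ⟨y, hy, hy'⟩ := hψ G ⟨b, hbB⟩
  have hy0 : IsLocalRing.residue B y ≠ 0 := by
    intro h0
    have h1 := minpoly.degree_le_of_ne_zero _ β hG0 (hy'.symm.trans h0)
    rw [← hmin, degree_X_pow_sub_C hp.out.pos] at h1
    exact (h1.trans_lt ((degree_map_le).trans_lt hGdeg)).false
  rw [IsLocalRing.residue_ne_zero_iff_isUnit, ValuationSubring.valuation_eq_one_iff, hy] at hy0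
  have hsum : ∑ i ∈ Finset.range p, algebraMap K L (c i) * b ^ i =
      algebraMap K L (c k) * aeval b (G.map (algebraMap A K)) := by
    rw [hG, Polynomial.map_sum, map_sum, Finset.mul_sum]
    refine Finset.sum_congr rfl fun i hi => ?_
    rw [Polynomial.map_mul, map_C, Polynomial.map_pow, map_X, map_mul, aeval_C, map_pow, aeval_X,
      ValuationSubring.algebraMap_apply, ha i (Finset.mem_range.1 hi), ← mul_assoc, ← map_mul,
      mul_div_cancel₀ _ hck]
  rw [hsum, map_mul, hy0, mul_one, map_mul, map_pow, hvb, one_pow, mul_one] at hlt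
  exact (hlt.trans_le (hmax j (Finset.mem_range.2 hj))).false

end ApproximateRoots

theorem IsSeparablyTame.divisible_and_perfect {K : Type*} [Field K] {A : ValuationSubring K}
    (hA : IsSeparablyTame A) (hA' : A ≠ ⊤) :
    IsValueGroupDivisible A (ringExpChar (IsLocalRing.ResidueField A)) ∧
      PerfectField (IsLocalRing.ResidueField A) := by
  obtain ⟨B, rfl⟩ := exists_extension (L := SeparableClosure K) A
  have hequiv := comap_valuation_isEquiv B (algebraMap K (SeparableClosure K))
  have hinv := hA.1.valuation_algEquiv_apply
  have hW := wildGroup_eq_bot_of_absoluteRamificationField_eq_top hinv (hA.2 B rfl)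
  set A := B.comap (algebraMap K (SeparableClosure K)) with hAB
  -- Nontriviality of the place enters here: π makes the separable perturbation of X^p − d small.
  obtain ⟨π, hπ0, hπ⟩ : ∃ π : K, π ≠ 0 ∧ A.valuation π < 1 := by
    obtain ⟨x, hx⟩ : ∃ x, x ∉ A := by
      by_contra! h
      exact hA' (eq_top_iff.2 fun x _ => h x)
    have hx0 : x ≠ 0 := by rintro rfl; exact hx A.zero_mem
    refine ⟨x⁻¹, inv_ne_zero hx0, ?_⟩
    rw [← A.valuation_le_one_iff, not_le] at hx
    rw [map_inv₀]
    exact inv_lt_one_of_one_lt₀ hx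
  have hp := ringExpChar.expChar (IsLocalRing.ResidueField A)
  generalize ringExpChar (IsLocalRing.ResidueField A) = p at hp
  have hexp := hp
  cases hp with
  -- In residue characteristic 0 the exponent is 1 and both claims are immediate.
  | zero => exact ⟨fun γ => ⟨γ, pow_one γ⟩, .ofCharZero⟩
  | prime hprime =>
    have := Fact.mk hprime
    have : CharP (IsLocalRing.ResidueField B) p := ⟨fun n => by
      rw [← CharP.cast_eq_zero_iff (IsLocalRing.ResidueField A) p, ← natCast_valuation_lt_one_iff,
        ← natCast_valuation_lt_one_iff, hequiv.lt_one_iff_lt_one, Valuation.comap_apply,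
        show algebraMap K (SeparableClosure K) n = n from map_natCast _ n]⟩
    have hπB := hequiv.lt_one_iff_lt_one.1 hπ
    constructor
    · refine isValueGroupDivisible_of_forall fun d hd => ?_
      obtain ⟨e, he⟩ := exists_valuation_pow_eq_of_wildGroup_eq_bot hinv hW (p := p) hπ0 hπB hd
      refine ⟨e, ?_⟩
      rw [← map_pow, hequiv.eq_iff, Valuation.comap_apply, map_pow, map_pow]
      exact he
    · have := PerfectRing.ofSurjective (IsLocalRing.ResidueField A) p
        fun δ => exists_residue_pow_eq_of_wildGroup_eq_bot hAB.symm hinv hW hπ0 hπB δ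
      exact PerfectRing.toPerfectField _ p

end ValuedPlace

open ValuedPlace in
/-- Here `ringExpChar (IsLocalRing.ResidueField A)` is `p = max (1, char KP)`. -/
theorem proposition2p11 {K : Type u} [Field K] (A : ValuationSubring K) (hA : A ≠ ⊤) :
    IsSeparablyTame A ↔
      (IsSeparableAlgebraicallyMaximal A ∧
        IsValueGroupDivisible A (ringExpChar (IsLocalRing.ResidueField A)) ∧
        PerfectField (IsLocalRing.ResidueField A)) := by
  refine ⟨fun h => ⟨h.isSeparableAlgebraicallyMaximal, h.divisible_and_perfect hA⟩, ?_⟩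
  rintro ⟨hmax, hdiv, hperf⟩
  exact isSeparablyTame_of_isSeparableAlgebraicallyMaximal hmax hdiv
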